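/- Let $d\ge 1$. Let $\mathcal D=\{[m2^k,(m+1)2^k): m,k\in\mathbb Z\}$ be the dyadic intervals of $\mathbb R$ and $\mathcal D^d$ the dyadic rectangles $R=R_{(1)}\times\cdots\times R_{(d)}$ of $\mathbb R^d$. For $\mathcal U\subset\mathcal D^d$ put $\operatorname{sh}(\mathcal U)=\bigcup_{R\in\mathcal U}R$. Let $\operatorname M f(x)=\sup_{R\ni x}|R|^{-1}\int_R|f(y)|\,dy$ be the strong maximal function, the supremum being over all (not necessarily dyadic) bounded rectangles $R\ni x$ with sides parallel to the coordinate axes and of positive length. Put $\operatorname{Enl}(\mathcal U)=\{\operatorname M\mathbf 1_{\operatorname{sh}(\mathcal U)}>\tfrac12\}$ and, for $R\in\mathcal U$, $$\operatorname{emb}(R;\mathcal U)=\sup\{\mu\ge1 : (\mu R_{(1)})\times R_{(2)}\times\cdots\times R_{(d)}\subset\operatorname{Enl}(\mathcal U)\},$$ where $\mu R_{(1)}$ is the interval with the same center as $R_{(1)}$ and $\mu$ times its length. For $\mathcal U'\subset\mathcal U$, $I\in\mathcal D$ and an integer $j\ge1$ put $$F(I,j,\mathcal U')=\bigcup\{R\in\mathcal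 U' : R_{(1)}=I,\ 2^{j-1}\le\operatorname{emb}(R;\mathcal U)<2^j\}.$$ For every $\epsilon>0$ there is a constant $C$, depending only on $d$ and $\epsilon$, such that for all $\mathcal U\subset\mathcal D^d$ with $|\operatorname{sh}(\mathcal U)|<\infty$ and all $\mathcal U'\subset\mathcal U$, $$\sum_{j=1}^\infty\sum_{I\in\mathcal D}2^{-\epsilon j}\,|F(I,j,\mathcal U')|\le C\,|\operatorname{sh}(\mathcal U')|.$$ Moreover, for every $\epsilon>0$, every integer $n>1$ and every $1<p<\infty$ there is a constant $C$, depending only on $d,\epsilon,n,p$, such that for all such $\mathcal U$ and $\mathcal U'$, $$\Bigl\|\sum_{j=1}^\infty\sum_{I\in\mathcal D}2^{-\epsilon j}\bigl(\operatorname M\mathbf 1_{F(I,j,\mathcal U')}\bigr)^n\Bigr\|_{L^p(\mathbb R^d)}\le C\,|\operatorname{sh}(\mathcal U')|^{1/p}.$$ -/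

import Mathlib

open MeasureTheory
open scoped ENNReal NNReal

noncomputable section

namespace Journe

/-- The dyadic interval `[pos * 2 ^ scale, (pos + 1) * 2 ^ scale)`.  Distinct pairs
`(scale, pos)` give distinct intervals. -/
@[ext]
structure DyadicInterval where
  scale : ℤ
  pos : ℤ

namespace DyadicInterval

/-- The side length `2 ^ scale`. -/
def length (I : DyadicInterval) : ℝ := (2 : ℝ) ^ I.scale

/-- The midpoint. -/
def center (I : DyadicInterval) : ℝ := ((I.pos : ℝ) + 1 / 2) * (2 : ℝ) ^ I.scale

/-- The interval as a subset of the line. -/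
def toSet (I : DyadicInterval) : Set ℝ :=
  Set.Ico ((I.pos : ℝ) * (2 : ℝ) ^ I.scale) (((I.pos : ℝ) + 1) * (2 : ℝ) ^ I.scale)

/-- The interval with the same center whose length is multiplied by `l`. -/
def dilate (l : ℝ) (I : DyadicInterval) : Set ℝ :=
  Set.Ico (I.center - l * I.length / 2) (I.center + l * I.length / 2)

end DyadicInterval

/-- A dyadic rectangle of `ℝ ^ d`, given by its sides. -/
abbrev DyadicRect (d : ℕ) : Type := Fin d → DyadicInterval

/-- The rectangle as a subset of `ℝ ^ d`. -/
def DyadicRect.toSet {d : ℕ} (R : DyadicRect d) : Set (Fin d → ℝ) :=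
  Set.univ.pi fun i => (R i).toSet

/-- The dilate of `R` by the factor `l i` in the `i`-th coordinate, with the same center. -/
def DyadicRect.dilate {d : ℕ} (l : Fin d → ℝ) (R : DyadicRect d) : Set (Fin d → ℝ) :=
  Set.univ.pi fun i => (R i).dilate (l i)

/-- The shadow: the union of the rectangles of the collection. -/
def shadow {d : ℕ} (U : Set (DyadicRect d)) : Set (Fin d → ℝ) :=
  ⋃ R ∈ U, DyadicRect.toSet R

/-- The strong maximal function: the supremum of the averages of `|f|` over all rectangles with
sides parallel to the axes that contain `x`.  Rectangles are taken open; closed or half-open ones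
give the same function. -/
def strongMaximal {d : ℕ} (f : (Fin d → ℝ) → ℝ) (x : Fin d → ℝ) : ℝ≥0∞ :=
  ⨆ (a : Fin d → ℝ) (b : Fin d → ℝ) (_ : x ∈ Set.univ.pi fun i => Set.Ioo (a i) (b i)),
    ⨍⁻ y in (Set.univ.pi fun i => Set.Ioo (a i) (b i)), ‖f y‖ₑ ∂volume

/-- The strong maximal function of the indicator function of a set. -/
def maximalIndicator {d : ℕ} (A : Set (Fin d → ℝ)) : (Fin d → ℝ) → ℝ≥0∞ :=
  strongMaximal (A.indicator fun _ => (1 : ℝ))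

/-- The enlarged set, where the strong maximal function of the indicator of the shadow
exceeds `1 / 2`. -/
def enlargement {d : ℕ} (U : Set (DyadicRect d)) : Set (Fin d → ℝ) :=
  {x | 1 / 2 < maximalIndicator (shadow U) x}

/-- The embeddedness of `R`: the supremum of the `μ ≥ 1` for which `R`, dilated by `μ` in the first
coordinate only, is contained in the enlarged set. -/
def emb {d : ℕ} [NeZero d] (R : DyadicRect d) (U : Set (DyadicRect d)) : ℝ≥0∞ :=
  ⨆ (μ : ℝ) (_ : 1 ≤ μ)
    (_ : DyadicRect.dilate (Function.update (fun _ => 1) 0 μ) R ⊆ enlargement U),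
    ENNReal.ofReal μ

/-- The union of the rectangles of `U'` whose first side is `I` and whose embeddedness (relative to
`U`) lies in `[2 ^ (j - 1), 2 ^ j)`. -/
def unionF {d : ℕ} [NeZero d] (U U' : Set (DyadicRect d)) (I : DyadicInterval) (j : ℕ) :
    Set (Fin d → ℝ) :=
  shadow {R | R ∈ U' ∧ R 0 = I ∧ (2 : ℝ≥0∞) ^ ((j : ℤ) - 1) ≤ emb R U ∧ emb R U < 2 ^ (j : ℤ)}

end Journe

end

/-! Fix `j` and remove from `F(I, j)` everything covered by the sets `F(J, j)` with `|J| ≥ 2 ^ j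
|I|`. What is left is the fresh part `D(I, j)`. Two facts about it carry the proof.

Each rectangle `R` of `F(I, j)` keeps a fifth of its volume in `D(I, j)`. Suppose instead that the
removed set `V` covers more than `4/5` of `R`. Let `I₀` be the dyadic ancestor of `I` of length `2 ^
j |I|`. A line in the first direction that meets `V` inside `R` stays in `V` along all of `I₀`, so
`V` also covers more than `4/5` of the rectangle with first side `I₀`. Stretching the first side by
at most `3/2` reaches any point of `R` dilated by `2 ^ j`, and `4/5 · 2/3 > 1/2`. Hence that dilate
lies in the enlarged set and `emb R ≥ 2 ^ j`, a contradiction (`dilate_subset_enlargement`,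
`volume_toSet_le_volume_inter_fresh`). Consequently the indicator of `F(I, j)` is at most a constant
times a maximal function of the indicator of `D(I, j)` (`one_le_iterMax_fresh`).

For fixed `j` the fresh parts overlap at most `j` times (`tsum_indicator_fresh_le`), and `∑ j 2 ^
(-ε j)` converges.

The first claim follows from the `L²` bound of the iterated directional maximal function, the second
from its Fefferman–Stein inequality (`fefferman_stein_iterMax`). Both rest on a weighted inequality
on the line (`strong_type_maxLine`), applied one coordinate at a time. -/

noncomputable section

namespace Journe

variable {d : ℕ}

/-! ### The maximal function on the line -/

/-- The average of `g` over the interval `(a, b)`. -/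
def lineAvg (g : ℝ → ℝ≥0∞) (a b : ℝ) : ℝ≥0∞ :=
  (ENNReal.ofReal (b - a))⁻¹ * ∫⁻ s in Set.Ioo a b, g s

/-- The maximal function on the line, over open intervals with rational endpoints. -/
def maxLine (g : ℝ → ℝ≥0∞) (t : ℝ) : ℝ≥0∞ :=
  ⨆ (a : ℚ) (b : ℚ), (Set.Ioo (a : ℝ) b).indicator (fun _ => lineAvg g a b) t

lemma lineAvg_le_maxLine (g : ℝ → ℝ≥0∞) (a b : ℚ) {t : ℝ} (ht : t ∈ Set.Ioo (a : ℝ) b) :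
    lineAvg g a b ≤ maxLine g t := by
  refine le_trans ?_ (le_iSup₂ (f := fun (a b : ℚ) =>
    (Set.Ioo (a : ℝ) b).indicator (fun _ => lineAvg g a b) t) a b)
  simp only [Set.indicator_of_mem ht, le_refl]

/-- Rational endpoints make the supremum countable, so `g` itself may be arbitrary. -/
lemma measurable_maxLine (g : ℝ → ℝ≥0∞) : Measurable (maxLine g) := by
  unfold maxLine
  exact .iSup fun a => .iSup fun b => measurable_const.indicator measurableSet_Ioo

lemma lt_maxLine_iff {g : ℝ → ℝ≥0∞} {t : ℝ} {l : ℝ≥0∞} :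
    l < maxLine g t ↔ ∃ a b : ℚ, t ∈ Set.Ioo (a : ℝ) b ∧ l < lineAvg g a b := by
  unfold maxLine
  simp only [lt_iSup_iff]
  refine exists_congr fun a => exists_congr fun b => ?_
  by_cases h : t ∈ Set.Ioo (a : ℝ) b
  · simp [h]
  · simp [h]

lemma maxLine_le {g : ℝ → ℝ≥0∞} {t : ℝ} {l : ℝ≥0∞}
    (h : ∀ a b : ℚ, t ∈ Set.Ioo (a : ℝ) b → lineAvg g a b ≤ l) : maxLine g t ≤ l := by
  refine iSup₂_le fun a b => ?_
  exact Set.indicator_apply_le' (h a b) fun _ => zero_le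

lemma lineAvg_mono {g h : ℝ → ℝ≥0∞} (hgh : ∀ t, g t ≤ h t) (a b : ℝ) :
    lineAvg g a b ≤ lineAvg h a b :=
  mul_le_mul_right (lintegral_mono fun s => hgh s) _

lemma maxLine_mono {g h : ℝ → ℝ≥0∞} (hgh : ∀ t, g t ≤ h t) (t : ℝ) :
    maxLine g t ≤ maxLine h t :=
  maxLine_le fun a b ht => (lineAvg_mono hgh a b).trans (lineAvg_le_maxLine h a b ht)

lemma lineAvg_const {a b : ℝ} (hab : a < b) (c : ℝ≥0∞) : lineAvg (fun _ => c) a b = c := by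
  unfold lineAvg
  rw [setLIntegral_const, Real.volume_Ioo, mul_comm c, ← mul_assoc, ENNReal.inv_mul_cancel, one_mul]
  · simpa using hab
  · exact ENNReal.ofReal_ne_top

lemma lineAvg_add (g : ℝ → ℝ≥0∞) {h : ℝ → ℝ≥0∞} (hh : Measurable h) (a b : ℝ) :
    lineAvg (fun t => g t + h t) a b = lineAvg g a b + lineAvg h a b := by
  unfold lineAvg
  rw [lintegral_add_right _ hh, mul_add]

lemma maxLine_const_le (c : ℝ≥0∞) (t : ℝ) : maxLine (fun _ => c) t ≤ c :=
  maxLine_le fun _ _ ht => (lineAvg_const (ht.1.trans ht.2) c).le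

lemma maxLine_add_const_le (g : ℝ → ℝ≥0∞) (c : ℝ≥0∞) (t : ℝ) :
    maxLine (fun t => g t + c) t ≤ maxLine g t + c :=
  maxLine_le fun a b ht => by
    rw [lineAvg_add g measurable_const, lineAvg_const (ht.1.trans ht.2)]
    exact add_le_add_left (lineAvg_le_maxLine g a b ht) c

lemma maxLine_const_mul_le (g : ℝ → ℝ≥0∞) {c : ℝ≥0∞} (hc : c ≠ ∞) (t : ℝ) :
    maxLine (fun t => c * g t) t ≤ c * maxLine g t :=
  maxLine_le fun a b ht => by
    calc lineAvg (fun t => c * g t) a b = c * lineAvg g a b := by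
          unfold lineAvg
          rw [lintegral_const_mul' _ _ hc, mul_left_comm]
      _ ≤ _ := mul_le_mul_right (lineAvg_le_maxLine g a b ht) _

lemma lintegral_Ioo_eq_mul_lineAvg (g : ℝ → ℝ≥0∞) {a b : ℝ} (hab : a < b) :
    ∫⁻ s in Set.Ioo a b, g s = ENNReal.ofReal (b - a) * lineAvg g a b := by
  unfold lineAvg
  rw [← mul_assoc, ENNReal.mul_inv_cancel, one_mul]
  · simpa using hab
  · exact ENNReal.ofReal_ne_top

/-- The factor `2` pays for rational endpoints: moving each end outwards by less than half the
length at most doubles the interval. -/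
lemma lineAvg_Icc_le_two_mul_maxLine (g : ℝ → ℝ≥0∞) {a b t : ℝ} (hab : a < b)
    (ht : t ∈ Set.Icc a b) :
    (ENNReal.ofReal (b - a))⁻¹ * ∫⁻ s in Set.Icc a b, g s ≤ 2 * maxLine g t := by
  obtain ⟨a', h1, h2⟩ := exists_rat_btwn (show a - (b - a) / 2 < a by linarith)
  obtain ⟨b', h3, h4⟩ := exists_rat_btwn (show b < b + (b - a) / 2 by linarith)
  have hab' : (a' : ℝ) < b' := by linarith
  have hm : t ∈ Set.Ioo (a' : ℝ) b' := ⟨by linarith [ht.1], by linarith [ht.2]⟩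
  have h0 : ENNReal.ofReal (b - a) ≠ 0 := by simpa using hab
  calc (ENNReal.ofReal (b - a))⁻¹ * ∫⁻ s in Set.Icc a b, g s
      ≤ (ENNReal.ofReal (b - a))⁻¹ * ∫⁻ s in Set.Ioo (a' : ℝ) b', g s := by
        gcongr
        exact fun x hx => ⟨by linarith [hx.1], by linarith [hx.2]⟩
    _ = (ENNReal.ofReal (b - a))⁻¹ * (ENNReal.ofReal (b' - a') * lineAvg g a' b') := by
        rw [lintegral_Ioo_eq_mul_lineAvg g hab']
    _ ≤ (ENNReal.ofReal (b - a))⁻¹ * ((2 * ENNReal.ofReal (b - a)) * maxLine g t) := by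
        gcongr
        · rw [← ENNReal.ofReal_ofNat, ← ENNReal.ofReal_mul (by norm_num)]
          exact ENNReal.ofReal_le_ofReal (by linarith)
        · exact lineAvg_le_maxLine g a' b' hm
    _ = 2 * maxLine g t := by
        rw [mul_comm 2, mul_assoc, ← mul_assoc, ENNReal.inv_mul_cancel h0 ENNReal.ofReal_ne_top,
          one_mul]

/-! ### Weighted weak type inequality by Vitali covering -/

/-- Weighted weak type inequality, for intervals of bounded length. -/
lemma weak_type_biUnion (g w : ℝ → ℝ≥0∞) (l : ℝ≥0∞) (T : Set (ℚ × ℚ)) (N : ℝ)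
    (hT : ∀ q ∈ T, q.1 < q.2 ∧ (q.2 - q.1 : ℝ) ≤ N ∧ l ≤ lineAvg g q.1 q.2) :
    l * volume.withDensity w (⋃ q ∈ T, Set.Ioo (q.1 : ℝ) q.2) ≤ 5 * ∫⁻ t, g t * maxLine w t := by
  -- With ratio `2`, every interval of `T` meets a selected one at least half as long, hence lies in
  -- its fivefold enlargement. The bound `N` on the lengths is what makes the selection possible.
  obtain ⟨u, huT, hd, hu⟩ := Vitali.exists_disjoint_subfamily_covering_enlargement
    (fun q : ℚ × ℚ => Set.Ioo (q.1 : ℝ) q.2) T (fun q => (q.2 - q.1 : ℝ)) 2 (by norm_num)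
    (fun q hq => by have : (q.1 : ℝ) < q.2 := by exact_mod_cast (hT q hq).1
                    linarith) N (fun q hq => (hT q hq).2.1)
    (fun q hq => Set.nonempty_Ioo.2 (by exact_mod_cast (hT q hq).1))
  have hcov : (⋃ q ∈ T, Set.Ioo (q.1 : ℝ) q.2) ⊆
      ⋃ q ∈ u, Set.Ioo ((q.1 - 2 * (q.2 - q.1) : ℚ) : ℝ) (q.2 + 2 * (q.2 - q.1) : ℚ) := by
    refine Set.iUnion₂_subset fun q hq t ht => ?_
    obtain ⟨r, hr, ⟨s, hs1, hs2⟩, hle⟩ := hu q hq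
    refine Set.mem_biUnion hr ?_
    simp only [Set.mem_Ioo] at *
    push_cast
    constructor <;> linarith
  have hterm : ∀ q ∈ u, l * volume.withDensity w
      (Set.Ioo ((q.1 - 2 * (q.2 - q.1) : ℚ) : ℝ) (q.2 + 2 * (q.2 - q.1) : ℚ)) ≤
      5 * ∫⁻ t in Set.Ioo (q.1 : ℝ) q.2, g t * maxLine w t := by
    intro q hq
    obtain ⟨hlt, -, hav⟩ := hT q (huT hq)
    have hlt' : (q.1 : ℝ) < q.2 := by exact_mod_cast hlt
    set a' : ℚ := q.1 - 2 * (q.2 - q.1) with ha'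
    set b' : ℚ := q.2 + 2 * (q.2 - q.1) with hb'
    have e1 : (a' : ℝ) = q.1 - 2 * (q.2 - q.1) := by rw [ha']; push_cast; ring
    have e2 : (b' : ℝ) = q.2 + 2 * (q.2 - q.1) := by rw [hb']; push_cast; ring
    rw [withDensity_apply _ measurableSet_Ioo, lintegral_Ioo_eq_mul_lineAvg w (by linarith)]
    have e3 : ENNReal.ofReal (b' - a') = 5 * ENNReal.ofReal (q.2 - q.1) := by
      rw [e1, e2, ← ENNReal.ofReal_ofNat, ← ENNReal.ofReal_mul (by norm_num)]
      congr 1; ring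
    calc l * (ENNReal.ofReal (b' - a') * lineAvg w a' b')
        ≤ lineAvg g q.1 q.2 * (5 * ENNReal.ofReal (q.2 - q.1) * lineAvg w a' b') := by
          rw [e3]; gcongr
      _ = 5 * ((ENNReal.ofReal (q.2 - q.1) * lineAvg g q.1 q.2) * lineAvg w a' b') := by ring
      _ = 5 * ((∫⁻ t in Set.Ioo (q.1 : ℝ) q.2, g t) * lineAvg w a' b') := by
          rw [lintegral_Ioo_eq_mul_lineAvg g hlt']
      _ ≤ 5 * ∫⁻ t in Set.Ioo (q.1 : ℝ) q.2, g t * lineAvg w a' b' := by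
          gcongr
          exact lintegral_mul_const_le _ _
      _ ≤ _ := by
          gcongr 5 * ?_
          -- The enlargement contains every `t` of the original interval, so the average of `w` over
          -- it is at most `maxLine w t`.
          refine setLIntegral_mono' measurableSet_Ioo fun t ht => ?_
          gcongr
          exact lineAvg_le_maxLine w a' b' ⟨by linarith [ht.1], by linarith [ht.2]⟩
  have huc : u.Countable := u.to_countable
  calc l * volume.withDensity w (⋃ q ∈ T, Set.Ioo (q.1 : ℝ) q.2)
      ≤ l * ∑' q : u, volume.withDensity w
          (Set.Ioo ((q.1.1 - 2 * (q.1.2 - q.1.1) : ℚ) : ℝ) (q.1.2 + 2 * (q.1.2 - q.1.1) : ℚ)) := by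
        gcongr
        exact (measure_mono hcov).trans (measure_biUnion_le _ huc _)
    _ ≤ ∑' q : u, 5 * ∫⁻ t in Set.Ioo (q.1.1 : ℝ) q.1.2, g t * maxLine w t := by
        rw [← ENNReal.tsum_mul_left]
        exact ENNReal.tsum_le_tsum fun q => hterm q.1 q.2
    _ = 5 * ∫⁻ t in ⋃ q ∈ u, Set.Ioo (q.1 : ℝ) q.2, g t * maxLine w t := by
        rw [ENNReal.tsum_mul_left, lintegral_biUnion huc (fun _ _ => measurableSet_Ioo) hd]
    _ ≤ _ := by
        gcongr
        exact Measure.restrict_le_self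

/-- The weighted weak type inequality for the maximal function on the line. -/
lemma weak_type_maxLine (g w : ℝ → ℝ≥0∞) (l : ℝ≥0∞) :
    l * volume.withDensity w {t | l < maxLine g t} ≤ 5 * ∫⁻ t, g t * maxLine w t := by
  -- Lengths are capped by `N` for the covering lemma; continuity from below of the measure removes
  -- the cap.
  set S : ℕ → Set (ℚ × ℚ) := fun N =>
    {q | q.1 < q.2 ∧ (q.2 - q.1 : ℝ) ≤ N ∧ l ≤ lineAvg g q.1 q.2}
  have hmono : Monotone fun N => ⋃ q ∈ S N, Set.Ioo (q.1 : ℝ) q.2 := by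
    intro N M hNM
    refine Set.biUnion_subset_biUnion_left fun q hq => ⟨hq.1, hq.2.1.trans ?_, hq.2.2⟩
    exact_mod_cast hNM
  have hsub : {t | l < maxLine g t} ⊆ ⋃ N, ⋃ q ∈ S N, Set.Ioo (q.1 : ℝ) q.2 := by
    intro t ht
    obtain ⟨a, b, hab, hl⟩ := lt_maxLine_iff.1 ht
    obtain ⟨N, hN⟩ := exists_nat_ge (b - a : ℝ)
    refine Set.mem_iUnion.2 ⟨N, Set.mem_biUnion (x := (a, b)) ⟨?_, hN, hl.le⟩ hab⟩
    exact_mod_cast hab.1.trans hab.2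
  calc l * volume.withDensity w {t | l < maxLine g t}
      ≤ l * volume.withDensity w (⋃ N, ⋃ q ∈ S N, Set.Ioo (q.1 : ℝ) q.2) := by gcongr
    _ = ⨆ N, l * volume.withDensity w (⋃ q ∈ S N, Set.Ioo (q.1 : ℝ) q.2) := by
        rw [hmono.measure_iUnion, ENNReal.mul_iSup]
    _ ≤ _ := iSup_le fun N => weak_type_biUnion g w l (S N) N fun q hq => hq


/-! ### Layer-cake integration and the weighted strong type inequality -/

lemma lintegral_Ioo_rpow {r Y : ℝ} (hr : 0 < r) (hY : 0 ≤ Y) :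
    ∫⁻ t in Set.Ioo 0 Y, ENNReal.ofReal (t ^ (r - 1)) = ENNReal.ofReal (Y ^ r / r) := by
  have hi : IntervalIntegrable (fun t : ℝ => t ^ (r - 1)) volume 0 Y :=
    intervalIntegral.intervalIntegrable_rpow' (by linarith)
  rw [← Measure.restrict_congr_set (Ioo_ae_eq_Ioc (μ := volume) (a := (0 : ℝ)) (b := Y)).symm,
    ← ofReal_integral_eq_lintegral_ofReal]
  · rw [← intervalIntegral.integral_of_le hY, integral_rpow (Or.inl (by linarith))]
    simp [Real.zero_rpow hr.ne']
  · exact (intervalIntegrable_iff_integrableOn_Ioc_of_le hY).1 hi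
  · filter_upwards [ae_restrict_mem measurableSet_Ioc] with t ht
    exact Real.rpow_nonneg ht.1.le _

/-- The integral of `t ^ (r - 1)` over the `t > 0` with `t < y`. -/
def layer (r : ℝ) (y : ℝ≥0∞) : ℝ≥0∞ :=
  ∫⁻ t in Set.Ioi (0 : ℝ), {t | ENNReal.ofReal t < y}.indicator
    (fun t => ENNReal.ofReal (t ^ (r - 1))) t

lemma layer_of_ne_top {r : ℝ} (hr : 0 < r) {y : ℝ≥0∞} (hy : y ≠ ∞) :
    layer r y = y ^ r / ENNReal.ofReal r := by
  have hs : {t : ℝ | ENNReal.ofReal t < y} ∩ Set.Ioi 0 = Set.Ioo 0 y.toReal := by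
    ext t
    simp only [Set.mem_inter_iff, Set.mem_ofPred_eq, Set.mem_Ioi, Set.mem_Ioo]
    constructor
    · rintro ⟨h1, h2⟩
      exact ⟨h2, (ENNReal.ofReal_lt_iff_lt_toReal h2.le hy).1 h1⟩
    · rintro ⟨h1, h2⟩
      exact ⟨(ENNReal.ofReal_lt_iff_lt_toReal h1.le hy).2 h2, h1⟩
  have hm : MeasurableSet {t : ℝ | ENNReal.ofReal t < y} :=
    measurableSet_lt ENNReal.measurable_ofReal measurable_const
  unfold layer
  rw [lintegral_indicator hm, Measure.restrict_restrict hm, hs,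
    lintegral_Ioo_rpow hr ENNReal.toReal_nonneg, ENNReal.ofReal_div_of_pos hr,
    ← ENNReal.ofReal_rpow_of_nonneg ENNReal.toReal_nonneg hr.le, ENNReal.ofReal_toReal hy]

lemma layer_mono (r : ℝ) : Monotone (layer r) := by
  intro y z hyz
  refine lintegral_mono fun t => ?_
  exact Set.indicator_le_indicator_of_subset (fun t ht => lt_of_lt_of_le ht hyz)
    (fun _ => zero_le) t

lemma layer_le {r : ℝ} (hr : 0 < r) (y : ℝ≥0∞) : layer r y ≤ y ^ r / ENNReal.ofReal r := by
  by_cases hy : y = ∞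
  · rw [hy, ENNReal.top_rpow_of_pos hr, ENNReal.top_div_of_ne_top ENNReal.ofReal_ne_top]
    exact le_top
  · exact (layer_of_ne_top hr hy).le

lemma rpow_le_layer {r : ℝ} (hr : 0 < r) (y : ℝ≥0∞) : y ^ r ≤ ENNReal.ofReal r * layer r y := by
  have key : ∀ z : ℝ≥0∞, z ≠ ∞ → z ^ r = ENNReal.ofReal r * layer r z := fun z hz => by
    rw [layer_of_ne_top hr hz, ENNReal.mul_div_cancel (by simpa using hr) ENNReal.ofReal_ne_top]
  by_cases hy : y = ∞
  · subst hy
    rw [ENNReal.top_rpow_of_pos hr]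
    refine le_of_forall_lt fun c hc => ?_
    -- At `y = ∞` the explicit formula is replaced by monotonicity: the finite value `(c + 1) ^ r⁻¹`
    -- already gives more than `c`.
    have h1 : (c + 1) ^ r⁻¹ ≠ ∞ := ENNReal.rpow_ne_top_of_nonneg (by positivity)
      (ENNReal.add_ne_top.2 ⟨hc.ne, ENNReal.one_ne_top⟩)
    calc c < c + 1 := ENNReal.lt_add_right hc.ne one_ne_zero
      _ = ((c + 1) ^ r⁻¹) ^ r := by rw [← ENNReal.rpow_mul, inv_mul_cancel₀ hr.ne', ENNReal.rpow_one]
      _ = ENNReal.ofReal r * layer r ((c + 1) ^ r⁻¹) := key _ h1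
      _ ≤ _ := by
        gcongr
        exact layer_mono r le_top
  · exact (key y hy).le

/-- Marcinkiewicz truncation: the values of `g` up to `t / 2` contribute at most `t / 2` to the
maximal function, so only the larger values matter, at level `t / 2`. The constant is `10 = 2 · 5`.
-/
lemma weak_type_maxLine_trunc (g w : ℝ → ℝ≥0∞) (t : ℝ) :
    ENNReal.ofReal t * volume.withDensity w {x | ENNReal.ofReal t < maxLine g x} ≤
      10 * ∫⁻ x, {x | ENNReal.ofReal t < 2 * g x}.indicator (fun x => g x * maxLine w x) x := by
  set h : ℝ → ℝ≥0∞ := {x | ENNReal.ofReal t < 2 * g x}.indicator g with hh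
  have e2 : ENNReal.ofReal t = 2 * ENNReal.ofReal (t / 2) := by
    rw [← ENNReal.ofReal_ofNat, ← ENNReal.ofReal_mul (by norm_num)]
    congr 1; ring
  have hsub : {x | ENNReal.ofReal t < maxLine g x} ⊆ {x | ENNReal.ofReal (t / 2) < maxLine h x} := by
    intro x hx
    simp only [Set.mem_ofPred_eq] at hx ⊢
    by_contra hcon
    refine hx.not_ge ?_
    calc maxLine g x ≤ maxLine (fun y => h y + ENNReal.ofReal (t / 2)) x := by
          refine maxLine_mono (fun y => ?_) x
          by_cases hy : ENNReal.ofReal t < 2 * g y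
          · rw [hh, Set.indicator_of_mem (by exact hy)]; exact le_self_add
          · rw [hh, Set.indicator_of_notMem (by exact hy), zero_add]
            rw [not_lt, e2] at hy
            exact (ENNReal.mul_le_mul_iff_right two_ne_zero (by norm_num)).1 hy
      _ ≤ maxLine h x + ENNReal.ofReal (t / 2) := maxLine_add_const_le _ _ _
      _ ≤ ENNReal.ofReal (t / 2) + ENNReal.ofReal (t / 2) := by gcongr; exact not_lt.1 hcon
      _ = ENNReal.ofReal t := by rw [e2, two_mul]
  calc ENNReal.ofReal t * volume.withDensity w {x | ENNReal.ofReal t < maxLine g x}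
      ≤ 2 * ENNReal.ofReal (t / 2) * volume.withDensity w {x | ENNReal.ofReal (t / 2) < maxLine h x} := by
        rw [← e2]; exact mul_le_mul_right (measure_mono hsub) _
    _ ≤ 2 * (5 * ∫⁻ x, h x * maxLine w x) := by
        rw [mul_assoc]; exact mul_le_mul_right (weak_type_maxLine h w _) _
    _ = _ := by
        rw [← mul_assoc]
        norm_num
        congr 1
        refine lintegral_congr fun x => ?_
        by_cases hy : ENNReal.ofReal t < 2 * g x
        · simp [hh, hy]
        · simp [hh, hy]

/-- The weighted strong type inequality for the maximal function on the line. -/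
lemma strong_type_maxLine {q : ℝ} (hq : 1 < q) :
    ∃ C : ℝ≥0∞, C ≠ ∞ ∧ ∀ g w : ℝ → ℝ≥0∞, Measurable g → Measurable w →
      ∫⁻ t, maxLine g t ^ q * w t ≤ C * ∫⁻ t, g t ^ q * maxLine w t := by
  -- `q` comes from the layer-cake formula, `10` from the truncated weak type bound, and the
  -- quotient from integrating `t ^ (q - 2)` over `0 < t < 2 g x`.
  refine ⟨ENNReal.ofReal q * (10 * (2 ^ (q - 1) / ENNReal.ofReal (q - 1))), ?_, ?_⟩
  · refine ENNReal.mul_ne_top ENNReal.ofReal_ne_top (ENNReal.mul_ne_top (by norm_num) ?_)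
    refine ENNReal.div_ne_top (ENNReal.rpow_ne_top_of_nonneg (by linarith) (by norm_num)) ?_
    simpa using hq
  intro g w hg hw
  have hM := measurable_maxLine g
  have hMw := measurable_maxLine w
  set ν := volume.withDensity w
  have hpow : Measurable fun t : ℝ => ENNReal.ofReal (t ^ (q - 1)) := by fun_prop
  have hpow' : Measurable fun t : ℝ => ENNReal.ofReal (t ^ (q - 1 - 1)) := by fun_prop
  have step1 : ∫⁻ x, layer q (maxLine g x) ∂ν =
      ∫⁻ t in Set.Ioi (0 : ℝ), ENNReal.ofReal (t ^ (q - 1)) *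
        ν {x | ENNReal.ofReal t < maxLine g x} := by
    unfold layer
    rw [lintegral_lintegral_swap]
    · refine lintegral_congr fun t => ?_
      have hm : MeasurableSet {x | ENNReal.ofReal t < maxLine g x} :=
        measurableSet_lt measurable_const hM
      rw [← lintegral_indicator_const hm]
      rfl
    · refine Measurable.aemeasurable ?_
      have : MeasurableSet {z : ℝ × ℝ | ENNReal.ofReal z.2 < maxLine g z.1} :=
        measurableSet_lt (by fun_prop) (by fun_prop)
      exact (hpow.comp measurable_snd).indicator this
  -- One factor `t` is spent on the weak type bound. The remaining power `q - 2` is integrable at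
  -- `0` because `1 < q`.
  have step2 : ∀ t ∈ Set.Ioi (0 : ℝ), ENNReal.ofReal (t ^ (q - 1)) *
      ν {x | ENNReal.ofReal t < maxLine g x} ≤
      10 * ∫⁻ x, g x * maxLine w x * {t | ENNReal.ofReal t < 2 * g x}.indicator
        (fun t => ENNReal.ofReal (t ^ (q - 1 - 1))) t := by
    intro t ht
    have ht' : (0 : ℝ) < t := ht
    calc _ = ENNReal.ofReal (t ^ (q - 1 - 1)) *
          (ENNReal.ofReal t * ν {x | ENNReal.ofReal t < maxLine g x}) := by
          rw [← mul_assoc, ← ENNReal.ofReal_mul (by positivity), ← Real.rpow_add_one ht'.ne']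
          congr 3; ring
      _ ≤ ENNReal.ofReal (t ^ (q - 1 - 1)) * (10 * ∫⁻ x, {x | ENNReal.ofReal t < 2 * g x}.indicator
            (fun x => g x * maxLine w x) x) := by
          exact mul_le_mul_right (weak_type_maxLine_trunc g w t) _
      _ = _ := by
          rw [mul_left_comm, ← lintegral_const_mul' _ _ ENNReal.ofReal_ne_top]
          congr 1
          refine lintegral_congr fun x => ?_
          by_cases hy : ENNReal.ofReal t < 2 * g x
          · simp only [Set.indicator_of_mem (show x ∈ {x | ENNReal.ofReal t < 2 * g x} from hy),
              Set.indicator_of_mem (show t ∈ {t | ENNReal.ofReal t < 2 * g x} from hy)]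
            exact mul_comm _ _
          · simp [hy]
  have step3 : ∫⁻ t in Set.Ioi (0 : ℝ), ∫⁻ x, g x * maxLine w x *
      {t | ENNReal.ofReal t < 2 * g x}.indicator (fun t => ENNReal.ofReal (t ^ (q - 1 - 1))) t =
      ∫⁻ x, g x * maxLine w x * layer (q - 1) (2 * g x) := by
    unfold layer
    have hind : Measurable fun z : ℝ × ℝ => {t | ENNReal.ofReal t < 2 * g z.1}.indicator
        (fun t => ENNReal.ofReal (t ^ (q - 1 - 1))) z.2 := by
      have : MeasurableSet {z : ℝ × ℝ | ENNReal.ofReal z.2 < 2 * g z.1} :=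
        measurableSet_lt (by fun_prop) (by fun_prop)
      exact (hpow'.comp measurable_snd).indicator this
    rw [lintegral_lintegral_swap]
    · refine lintegral_congr fun x => ?_
      rw [lintegral_const_mul]
      exact hind.comp (measurable_const.prodMk measurable_id)
    · refine Measurable.aemeasurable ?_
      have h2 : Measurable fun z : ℝ × ℝ => g z.2 * maxLine w z.2 := by fun_prop
      exact h2.mul (hind.comp measurable_swap)
  calc ∫⁻ t, maxLine g t ^ q * w t = ∫⁻ x, maxLine g x ^ q ∂ν := by
        rw [lintegral_withDensity_eq_lintegral_mul _ hw (hM.pow_const q)]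
        exact lintegral_congr fun x => mul_comm _ _
    _ ≤ ∫⁻ x, ENNReal.ofReal q * layer q (maxLine g x) ∂ν :=
        lintegral_mono fun x => rpow_le_layer (by linarith) _
    _ = ENNReal.ofReal q * ∫⁻ x, layer q (maxLine g x) ∂ν :=
        lintegral_const_mul' _ _ ENNReal.ofReal_ne_top
    _ ≤ ENNReal.ofReal q * ∫⁻ t in Set.Ioi (0 : ℝ), 10 * ∫⁻ x, g x * maxLine w x *
          {t | ENNReal.ofReal t < 2 * g x}.indicator
            (fun t => ENNReal.ofReal (t ^ (q - 1 - 1))) t := by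
        rw [step1]
        gcongr ENNReal.ofReal q * ?_
        exact setLIntegral_mono' measurableSet_Ioi step2
    _ = ENNReal.ofReal q * (10 * ∫⁻ x, g x * maxLine w x * layer (q - 1) (2 * g x)) := by
        rw [lintegral_const_mul' _ _ (by norm_num), step3]
    _ ≤ ENNReal.ofReal q * (10 * ∫⁻ x, (2 ^ (q - 1) / ENNReal.ofReal (q - 1)) *
          (g x ^ q * maxLine w x)) := by
        refine mul_le_mul_right (mul_le_mul_right (lintegral_mono fun x => ?_) _) _
        calc g x * maxLine w x * layer (q - 1) (2 * g x)
            ≤ g x * maxLine w x * ((2 * g x) ^ (q - 1) / ENNReal.ofReal (q - 1)) := by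
              gcongr; exact layer_le (by linarith) _
          _ = (2 ^ (q - 1) / ENNReal.ofReal (q - 1)) * ((g x ^ (1 : ℝ) * g x ^ (q - 1)) * maxLine w x) := by
              rw [ENNReal.mul_rpow_of_nonneg _ _ (by linarith), ENNReal.rpow_one]
              simp only [div_eq_mul_inv]
              ring
          _ = _ := by
              rw [← ENNReal.rpow_add_of_nonneg _ _ (by norm_num) (by linarith)]
              congr 3; ring
    _ = _ := by
        rw [lintegral_const_mul _ (by fun_prop)]
        simp only [mul_assoc]


/-! ### Directional maximal functions -/

/-- The maximal function in the direction of the `i`-th coordinate. -/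
def dirMax (i : Fin d) (f : (Fin d → ℝ) → ℝ≥0∞) (x : Fin d → ℝ) : ℝ≥0∞ :=
  maxLine (fun s => f (Function.update x i s)) (x i)

lemma dirMax_update (i : Fin d) (f : (Fin d → ℝ) → ℝ≥0∞) (x : Fin d → ℝ) (t : ℝ) :
    dirMax i f (Function.update x i t) = maxLine (fun s => f (Function.update x i s)) t := by
  simp [dirMax]

lemma measurable_dirMax (i : Fin d) {f : (Fin d → ℝ) → ℝ≥0∞} (hf : Measurable f) :
    Measurable (dirMax i f) := by
  unfold dirMax maxLine lineAvg
  refine .iSup fun a => .iSup fun b => ?_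
  have h1 : Measurable fun z : (Fin d → ℝ) × ℝ => f (Function.update z.1 i z.2) :=
    hf.comp measurable_update'
  have h2 : Measurable fun x : Fin d → ℝ =>
      (ENNReal.ofReal (b - a))⁻¹ * ∫⁻ s in Set.Ioo (a : ℝ) b, f (Function.update x i s) :=
    (h1.lintegral_prod_right' (ν := volume.restrict (Set.Ioo (a : ℝ) b))).const_mul _
  exact h2.indicator (measurable_pi_apply i measurableSet_Ioo)

lemma dirMax_mono (i : Fin d) {f g : (Fin d → ℝ) → ℝ≥0∞} (h : ∀ x, f x ≤ g x) (x : Fin d → ℝ) :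
    dirMax i f x ≤ dirMax i g x :=
  maxLine_mono (fun _ => h _) _

lemma dirMax_const_mul_le (i : Fin d) (f : (Fin d → ℝ) → ℝ≥0∞) {c : ℝ≥0∞} (hc : c ≠ ∞)
    (x : Fin d → ℝ) : dirMax i (fun y => c * f y) x ≤ c * dirMax i f x :=
  maxLine_const_mul_le _ hc _

/-- An inequality between integrals may be checked on the lines in a coordinate direction. -/
lemma lintegral_le_of_forall_line (i : Fin d) {F G : (Fin d → ℝ) → ℝ≥0∞} (hF : Measurable F)
    (hG : Measurable G)
    (h : ∀ x, ∫⁻ t, F (Function.update x i t) ≤ ∫⁻ t, G (Function.update x i t)) :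
    ∫⁻ x, F x ≤ ∫⁻ x, G x := by
  refine lintegral_le_of_lmarginal_le (μ := fun _ => volume) {i} hF hG ?_
  rw [lmarginal_singleton, lmarginal_singleton]
  exact h

lemma strong_type_dirMax {q : ℝ} (hq : 1 < q) :
    ∃ C : ℝ≥0∞, C ≠ ∞ ∧ ∀ (i : Fin d) (f w : (Fin d → ℝ) → ℝ≥0∞), Measurable f → Measurable w →
      ∫⁻ x, dirMax i f x ^ q * w x ≤ C * ∫⁻ x, f x ^ q * dirMax i w x := by
  obtain ⟨C, hC, h⟩ := strong_type_maxLine hq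
  refine ⟨C, hC, fun i f w hf hw => ?_⟩
  have h1 := measurable_dirMax i hf
  have h2 := measurable_dirMax i hw
  rw [← lintegral_const_mul' _ _ hC]
  refine lintegral_le_of_forall_line i (by fun_prop) (by fun_prop) fun x => ?_
  simp only [dirMax_update]
  rw [lintegral_const_mul' _ _ hC]
  exact h _ _ (hf.comp (measurable_update x)) (hw.comp (measurable_update x))

/-- The weighted inequality with weight `1`, whose maximal function is at most `1`. -/
lemma lintegral_dirMax_rpow_le {q : ℝ} (hq : 1 < q) :
    ∃ C : ℝ≥0∞, C ≠ ∞ ∧ ∀ (i : Fin d) (f : (Fin d → ℝ) → ℝ≥0∞), Measurable f →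
      ∫⁻ x, dirMax i f x ^ q ≤ C * ∫⁻ x, f x ^ q := by
  obtain ⟨C, hC, h⟩ := strong_type_dirMax (d := d) hq
  refine ⟨C, hC, fun i f hf => ?_⟩
  calc ∫⁻ x, dirMax i f x ^ q = ∫⁻ x, dirMax i f x ^ q * (fun _ => 1) x := by simp
    _ ≤ C * ∫⁻ x, f x ^ q * dirMax i (fun _ => 1) x := h i f _ hf measurable_const
    _ ≤ C * ∫⁻ x, f x ^ q * 1 := by
        refine mul_le_mul_right (lintegral_mono fun x => mul_le_mul_right ?_ _) _
        exact maxLine_const_le 1 _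
    _ = _ := by simp

/-! ### Duality and the Fefferman–Stein inequality -/

/-- The converse of Hölder's inequality. -/
lemma lintegral_rpow_le_of_forall_lintegral_mul_le {α : Type*} [MeasurableSpace α]
    {μ : Measure α} [SigmaFinite μ] {p p' : ℝ} (hp : p.HolderConjugate p') {G : α → ℝ≥0∞}
    (hG : Measurable G) (K : ℝ≥0∞)
    (h : ∀ φ : α → ℝ≥0∞, Measurable φ → ∫⁻ x, G x * φ x ∂μ ≤ K * (∫⁻ x, φ x ^ p' ∂μ) ^ (1 / p')) :
    ∫⁻ x, G x ^ p ∂μ ≤ K ^ p := by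
  have hp0 : 0 < p := hp.pos
  -- Truncating both height and support makes `∫ T ^ p` finite, which is needed to divide by a power
  -- of it.
  set T : ℕ → α → ℝ≥0∞ := fun N => (spanningSets μ N).indicator fun x => min (G x) N with hT
  have hTm : ∀ N, Measurable (T N) := fun N =>
    (hG.min measurable_const).indicator (measurableSet_spanningSets μ N)
  have hTG : ∀ N x, T N x ≤ G x := fun N x =>
    (Set.indicator_le_self' (fun _ _ => zero_le) x).trans (min_le_left _ _)
  have hTmono : Monotone T := by
    intro N M hNM x
    simp only [hT]
    refine (Set.indicator_le_indicator_of_subset (monotone_spanningSets μ hNM)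
      (fun _ => zero_le) x).trans (Set.indicator_le_indicator ?_)
    exact min_le_min_left _ (by exact_mod_cast hNM)
  have hfin : ∀ N, ∫⁻ x, T N x ^ p ∂μ ≠ ∞ := by
    intro N
    have : ∫⁻ x, T N x ^ p ∂μ ≤ ∫⁻ x in spanningSets μ N, (N : ℝ≥0∞) ^ p ∂μ := by
      rw [← lintegral_indicator (measurableSet_spanningSets μ N)]
      refine lintegral_mono fun x => ?_
      by_cases hx : x ∈ spanningSets μ N
      · simp only [hT, Set.indicator_of_mem hx]
        exact ENNReal.rpow_le_rpow (min_le_right _ _) hp0.le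
      · simp [hT, hx, hp0]
    refine ne_top_of_le_ne_top ?_ this
    rw [setLIntegral_const]
    exact ENNReal.mul_ne_top (ENNReal.rpow_ne_top_of_nonneg hp0.le (by simp))
      (measure_spanningSets_lt_top μ N).ne
  have hbound : ∀ N, ∫⁻ x, T N x ^ p ∂μ ≤ K ^ p := by
    intro N
    set X := ∫⁻ x, T N x ^ p ∂μ with hX
    by_cases hX0 : X = 0
    · rw [hX0]; exact zero_le
    -- The test function is `T ^ (p - 1)`, whose `p'`-th power is `T ^ p`.
    have h1 : X ≤ K * X ^ (1 / p') := by
      calc X ≤ ∫⁻ x, G x * T N x ^ (p - 1) ∂μ := by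
            refine lintegral_mono fun x => ?_
            calc T N x ^ p = T N x ^ (1 : ℝ) * T N x ^ (p - 1) := by
                  rw [← ENNReal.rpow_add_of_nonneg _ _ zero_le_one hp.sub_one_pos.le]
                  congr 1; ring
              _ ≤ _ := by rw [ENNReal.rpow_one]; exact mul_le_mul_left (hTG N x) _
        _ ≤ K * (∫⁻ x, (T N x ^ (p - 1)) ^ p' ∂μ) ^ (1 / p') := h _ ((hTm N).pow_const _)
        _ = K * X ^ (1 / p') := by
            simp only [← ENNReal.rpow_mul, hp.sub_one_mul_conj, hX]
    have h2 : X = X ^ (1 / p) * X ^ (1 / p') := by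
      rw [← ENNReal.rpow_add _ _ hX0 (hfin N), hp.one_div_add_one_div, div_one, ENNReal.rpow_one]
    have h3 : X ^ (1 / p) ≤ K := by
      have hp' := hp.symm.pos
      refine (ENNReal.mul_le_mul_iff_left ?_ ?_).1 (h2.symm.trans_le h1)
      · simp [ENNReal.rpow_eq_zero_iff, hX0, hp'.not_gt]
      · exact ENNReal.rpow_ne_top_of_nonneg (by positivity) (hfin N)
    calc X = (X ^ (1 / p)) ^ p := by rw [← ENNReal.rpow_mul, one_div_mul_cancel hp0.ne', ENNReal.rpow_one]
      _ ≤ K ^ p := ENNReal.rpow_le_rpow h3 hp0.le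
  have hsup : ∀ x, G x ^ p ≤ ⨆ N, T N x ^ p := by
    intro x
    obtain ⟨N₀, hN₀⟩ := Set.mem_iUnion.1 (iUnion_spanningSets μ ▸ Set.mem_univ x)
    have ht : Filter.Tendsto (fun N : ℕ => T N x) Filter.atTop (nhds (G x)) := by
      have h1 : Filter.Tendsto (fun N : ℕ => min (G x) (N : ℝ≥0∞)) Filter.atTop
          (nhds (min (G x) ∞)) := tendsto_const_nhds.min ENNReal.tendsto_nat_nhds_top
      rw [min_eq_left le_top] at h1
      refine h1.congr' ?_
      filter_upwards [Filter.eventually_ge_atTop N₀] with N hN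
      simp only [hT, Set.indicator_of_mem (monotone_spanningSets μ hN hN₀)]
    exact le_of_tendsto' ((ENNReal.continuous_rpow_const.tendsto _).comp ht)
      fun N => le_iSup (fun N => T N x ^ p) N
  calc ∫⁻ x, G x ^ p ∂μ ≤ ∫⁻ x, ⨆ N, T N x ^ p ∂μ := lintegral_mono hsup
    _ = ⨆ N, ∫⁻ x, T N x ^ p ∂μ :=
        lintegral_iSup (fun N => (hTm N).pow_const p)
          fun N M hNM x => ENNReal.rpow_le_rpow (hTmono hNM x) hp0.le
    _ ≤ K ^ p := iSup_le hbound

/-- The Fefferman–Stein inequality for the maximal function in a coordinate direction. -/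
lemma fefferman_stein_dirMax {n : ℕ} (hn : 1 < n) {p : ℝ} (hp : 1 < p) :
    ∃ C : ℝ≥0∞, C ≠ ∞ ∧ ∀ (κ : Type) [Countable κ] (i : Fin d) (a : κ → ℝ≥0∞)
      (f : κ → (Fin d → ℝ) → ℝ≥0∞), (∀ k, Measurable (f k)) →
      ∫⁻ x, (∑' k, a k * dirMax i (f k) x ^ n) ^ p ≤ C * ∫⁻ x, (∑' k, a k * f k x ^ n) ^ p := by
  obtain ⟨p', hpp⟩ : ∃ p', p.HolderConjugate p' := ⟨_, Real.HolderConjugate.conjExponent hp⟩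
  obtain ⟨A, hA, hweight⟩ := strong_type_dirMax (d := d) (q := n) (by exact_mod_cast hn)
  obtain ⟨B, hB, hstrong⟩ := lintegral_dirMax_rpow_le (d := d) hpp.symm.lt
  refine ⟨(A * B ^ (1 / p')) ^ p, ?_, ?_⟩
  · exact ENNReal.rpow_ne_top_of_nonneg hpp.nonneg (ENNReal.mul_ne_top hA
      (ENNReal.rpow_ne_top_of_nonneg (by have := hpp.symm.pos; positivity) hB))
  intro κ _ i a f hf
  have hm : ∀ k, Measurable (dirMax i (f k)) := fun k => measurable_dirMax i (hf k)
  set H := fun x => ∑' k, a k * f k x ^ n with hH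
  have hHm : Measurable H := .tsum fun k => by fun_prop
  set K := A * B ^ (1 / p') * (∫⁻ x, H x ^ p) ^ (1 / p) with hK
  have main := lintegral_rpow_le_of_forall_lintegral_mul_le (μ := volume) hpp
    (G := fun x => ∑' k, a k * dirMax i (f k) x ^ n) (.tsum fun k => by fun_prop) K ?_
  · refine main.trans_eq ?_
    rw [hK, ENNReal.mul_rpow_of_nonneg _ _ hpp.nonneg, ← ENNReal.rpow_mul _ (1 / p),
      one_div_mul_cancel hpp.pos.ne', ENNReal.rpow_one]
  intro φ hφ
  have hφm := measurable_dirMax i hφ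
  calc ∫⁻ x, (∑' k, a k * dirMax i (f k) x ^ n) * φ x
      = ∑' k, a k * ∫⁻ x, dirMax i (f k) x ^ (n : ℝ) * φ x := by
        simp only [← ENNReal.tsum_mul_right, ENNReal.rpow_natCast]
        rw [lintegral_tsum fun k => by fun_prop]
        refine tsum_congr fun k => ?_
        rw [← lintegral_const_mul _ (by fun_prop)]
        simp only [mul_assoc]
    _ ≤ ∑' k, a k * (A * ∫⁻ x, f k x ^ (n : ℝ) * dirMax i φ x) :=
        ENNReal.tsum_le_tsum fun k => mul_le_mul_right (hweight i (f k) φ (hf k) hφ) _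
    _ = A * ∫⁻ x, H x * dirMax i φ x := by
        simp only [hH, ← ENNReal.tsum_mul_right, ENNReal.rpow_natCast]
        rw [lintegral_tsum fun k => by fun_prop, ← ENNReal.tsum_mul_left]
        refine tsum_congr fun k => ?_
        rw [mul_left_comm, ← lintegral_const_mul _ (by fun_prop)]
        simp only [mul_assoc]
    _ ≤ A * ((∫⁻ x, H x ^ p) ^ (1 / p) * (∫⁻ x, dirMax i φ x ^ p') ^ (1 / p')) :=
        mul_le_mul_right (ENNReal.lintegral_mul_le_Lp_mul_Lq volume hpp hHm.aemeasurable
          hφm.aemeasurable) _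
    _ ≤ A * ((∫⁻ x, H x ^ p) ^ (1 / p) * (B * ∫⁻ x, φ x ^ p') ^ (1 / p')) := by
        have := hpp.symm.pos
        gcongr
        exact hstrong i φ hφ
    _ = K * (∫⁻ x, φ x ^ p') ^ (1 / p') := by
        rw [ENNReal.mul_rpow_of_nonneg _ _ (by have := hpp.symm.pos; positivity), hK]
        ring

/-- The composition of the directional maximal functions for the directions in `l`. -/
def iterMax (l : List (Fin d)) (f : (Fin d → ℝ) → ℝ≥0∞) : (Fin d → ℝ) → ℝ≥0∞ :=
  l.foldr dirMax f

lemma measurable_iterMax (l : List (Fin d)) {f : (Fin d → ℝ) → ℝ≥0∞} (hf : Measurable f) :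
    Measurable (iterMax l f) := by
  induction l with
  | nil => exact hf
  | cons i l ih => exact measurable_dirMax i ih

lemma iterMax_mono (l : List (Fin d)) {f g : (Fin d → ℝ) → ℝ≥0∞} (h : ∀ x, f x ≤ g x)
    (x : Fin d → ℝ) : iterMax l f x ≤ iterMax l g x := by
  induction l generalizing x with
  | nil => exact h x
  | cons i l ih => exact dirMax_mono i ih x

lemma iterMax_const_mul_le (l : List (Fin d)) (f : (Fin d → ℝ) → ℝ≥0∞) {c : ℝ≥0∞} (hc : c ≠ ∞)
    (x : Fin d → ℝ) : iterMax l (fun y => c * f y) x ≤ c * iterMax l f x := by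
  induction l generalizing x with
  | nil => exact le_rfl
  | cons i l ih => exact (dirMax_mono i ih x).trans (dirMax_const_mul_le i _ hc x)

lemma lintegral_iterMax_rpow_le {q : ℝ} (hq : 1 < q) (l : List (Fin d)) :
    ∃ C : ℝ≥0∞, C ≠ ∞ ∧ ∀ f : (Fin d → ℝ) → ℝ≥0∞, Measurable f →
      ∫⁻ x, iterMax l f x ^ q ≤ C * ∫⁻ x, f x ^ q := by
  obtain ⟨A, hA, h⟩ := lintegral_dirMax_rpow_le (d := d) hq
  induction l with
  | nil => exact ⟨1, by simp, fun f _ => by simp [iterMax]⟩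
  | cons i l ih =>
    obtain ⟨C, hC, hl⟩ := ih
    refine ⟨A * C, ENNReal.mul_ne_top hA hC, fun f hf => ?_⟩
    calc _ ≤ A * ∫⁻ x, iterMax l f x ^ q := h i _ (measurable_iterMax l hf)
      _ ≤ A * (C * ∫⁻ x, f x ^ q) := mul_le_mul_right (hl f hf) _
      _ = _ := (mul_assoc _ _ _).symm

lemma fefferman_stein_iterMax {n : ℕ} (hn : 1 < n) {p : ℝ} (hp : 1 < p) (l : List (Fin d)) :
    ∃ C : ℝ≥0∞, C ≠ ∞ ∧ ∀ (κ : Type) [Countable κ] (a : κ → ℝ≥0∞)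
      (f : κ → (Fin d → ℝ) → ℝ≥0∞), (∀ k, Measurable (f k)) →
      ∫⁻ x, (∑' k, a k * iterMax l (f k) x ^ n) ^ p ≤ C * ∫⁻ x, (∑' k, a k * f k x ^ n) ^ p := by
  obtain ⟨A, hA, h⟩ := fefferman_stein_dirMax (d := d) hn hp
  induction l with
  | nil => exact ⟨1, by simp, fun κ _ a f _ => by simp [iterMax]⟩
  | cons i l ih =>
    obtain ⟨C, hC, hl⟩ := ih
    refine ⟨A * C, ENNReal.mul_ne_top hA hC, fun κ _ a f hf => ?_⟩
    calc _ ≤ A * ∫⁻ x, (∑' k, a k * iterMax l (f k) x ^ n) ^ p :=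
          h κ i a _ fun k => measurable_iterMax l (hf k)
      _ ≤ A * (C * ∫⁻ x, (∑' k, a k * f k x ^ n) ^ p) := mul_le_mul_right (hl κ a f hf) _
      _ = _ := (mul_assoc _ _ _).symm


lemma lmarginal_Icc_le_iterMax {f : (Fin d → ℝ) → ℝ≥0∞} (hf : Measurable f) {a b : Fin d → ℝ}
    (hab : ∀ i, a i < b i) {l : List (Fin d)} (hl : l.Nodup) {x : Fin d → ℝ}
    (hx : x ∈ Set.univ.pi fun i => Set.Icc (a i) (b i)) :
    (∫⋯∫⁻_l.toFinset, f ∂fun i => (volume : Measure ℝ).restrict (Set.Icc (a i) (b i))) x ≤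
      (l.map fun i => 2 * ENNReal.ofReal (b i - a i)).prod * iterMax l f x := by
  induction l generalizing x with
  | nil => simp [iterMax]
  | cons i l ih =>
    rw [List.nodup_cons] at hl
    have h0 : ENNReal.ofReal (b i - a i) ≠ 0 := by simpa using hab i
    rw [List.toFinset_cons, lmarginal_insert f hf (by simpa using hl.1), List.map_cons,
      List.prod_cons]
    set c := (l.map fun i => 2 * ENNReal.ofReal (b i - a i)).prod
    have hupd : ∀ t ∈ Set.Icc (a i) (b i),
        Function.update x i t ∈ Set.univ.pi fun i => Set.Icc (a i) (b i) := by
      intro t ht j _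
      rcases eq_or_ne j i with rfl | hj
      · simpa using ht
      · simpa [hj] using hx j trivial
    have hm : Measurable fun t => iterMax l f (Function.update x i t) :=
      (measurable_iterMax l hf).comp (measurable_update x)
    calc _ ≤ ∫⁻ t in Set.Icc (a i) (b i), c * iterMax l f (Function.update x i t) :=
          setLIntegral_mono' measurableSet_Icc fun t ht => ih hl.2 (hupd t ht)
      _ = c * (ENNReal.ofReal (b i - a i) * ((ENNReal.ofReal (b i - a i))⁻¹ *
            ∫⁻ t in Set.Icc (a i) (b i), iterMax l f (Function.update x i t))) := by
          rw [lintegral_const_mul _ hm, ← mul_assoc (ENNReal.ofReal _),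
            ENNReal.mul_inv_cancel h0 ENNReal.ofReal_ne_top, one_mul]
      _ ≤ c * (ENNReal.ofReal (b i - a i) * (2 * iterMax (i :: l) f x)) := by
          refine mul_le_mul_right (mul_le_mul_right ?_ _) _
          exact lineAvg_Icc_le_two_mul_maxLine _ (hab i) (hx i trivial)
      _ = _ := by ring

/-- Averages over a box are controlled by the iterated maximal function on the box. -/
lemma lintegral_Icc_le_iterMax {f : (Fin d → ℝ) → ℝ≥0∞} (hf : Measurable f) {a b : Fin d → ℝ}
    (hab : ∀ i, a i < b i) {x : Fin d → ℝ} (hx : x ∈ Set.univ.pi fun i => Set.Icc (a i) (b i)) :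
    ∫⁻ y in Set.univ.pi fun i => Set.Icc (a i) (b i), f y ≤
      volume (Set.univ.pi fun i => Set.Icc (a i) (b i)) *
        (2 ^ d * iterMax (List.finRange d) f x) := by
  have h := lmarginal_Icc_le_iterMax hf hab (List.nodup_finRange d) hx
  rw [List.toFinset_finRange, lmarginal_univ, ← Measure.restrict_pi_pi, ← volume_pi,
    ← Fin.prod_univ_def, Finset.prod_mul_distrib] at h
  refine h.trans_eq ?_
  rw [volume_pi_pi]
  simp only [Real.volume_Icc, Finset.prod_const, Finset.card_univ, Fintype.card_fin]
  ring

lemma volume_Ioo_box_eq (a b : Fin d → ℝ) :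
    volume (Set.univ.pi fun i => Set.Ioo (a i) (b i)) =
      volume (Set.univ.pi fun i => Set.Icc (a i) (b i)) := by
  simp only [volume_pi_pi, Real.volume_Ioo, Real.volume_Icc]

lemma strongMaximal_le_iterMax {f : (Fin d → ℝ) → ℝ} (hf : Measurable f) (x : Fin d → ℝ) :
    strongMaximal f x ≤ 2 ^ d * iterMax (List.finRange d) (fun y => ‖f y‖ₑ) x := by
  refine iSup_le fun a => iSup_le fun b => iSup_le fun hx => ?_
  have hab : ∀ i, a i < b i := fun i => (hx i trivial).1.trans (hx i trivial).2
  rw [setLAverage_eq]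
  refine ENNReal.div_le_of_le_mul' ?_
  rw [volume_Ioo_box_eq]
  refine le_trans ?_ (lintegral_Icc_le_iterMax hf.enorm hab
    fun i _ => ⟨(hx i trivial).1.le, (hx i trivial).2.le⟩)
  exact lintegral_mono_set (Set.pi_mono fun i _ => Set.Ioo_subset_Icc_self)

lemma enorm_indicator_one (A : Set (Fin d → ℝ)) (y : Fin d → ℝ) :
    ‖A.indicator (fun _ => (1 : ℝ)) y‖ₑ = A.indicator (fun _ => (1 : ℝ≥0∞)) y := by
  by_cases h : y ∈ A <;> simp [h]

lemma maximalIndicator_le_iterMax {A : Set (Fin d → ℝ)} (hA : MeasurableSet A) (x : Fin d → ℝ) :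
    maximalIndicator A x ≤
      2 ^ d * iterMax (List.finRange d) (A.indicator fun _ => (1 : ℝ≥0∞)) x := by
  refine (strongMaximal_le_iterMax (measurable_const.indicator hA) x).trans_eq ?_
  simp only [enorm_indicator_one]

/-- A point of a closed box more than half of which is covered by `A` lies in the set where the
strong maximal function of the indicator of `A` exceeds `1 / 2`. -/
lemma half_lt_maximalIndicator {A : Set (Fin d → ℝ)} (hA : MeasurableSet A) {a b : Fin d → ℝ}
    (hab : ∀ i, a i < b i) {x : Fin d → ℝ} (hx : x ∈ Set.univ.pi fun i => Set.Icc (a i) (b i))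
    (h : volume (Set.univ.pi fun i => Set.Icc (a i) (b i)) <
      2 * volume (A ∩ Set.univ.pi fun i => Set.Icc (a i) (b i))) :
    1 / 2 < maximalIndicator A x := by
  have hcont : Continuous fun δ : ℝ => ENNReal.ofReal (∏ i, ((b i + δ) - (a i - δ))) :=
    ENNReal.continuous_ofReal.comp (by fun_prop)
  have h0 : ENNReal.ofReal (∏ i, ((b i + 0) - (a i - 0))) <
      2 * volume (A ∩ Set.univ.pi fun i => Set.Icc (a i) (b i)) := by
    refine lt_of_eq_of_lt ?_ h
    rw [volume_pi_pi, ENNReal.ofReal_prod_of_nonneg fun i _ => by linarith [hab i]]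
    simp
  obtain ⟨δ, hδ, hδ0⟩ := (((hcont.tendsto 0).eventually_lt_const h0).filter_mono
    nhdsWithin_le_nhds |>.and (self_mem_nhdsWithin (s := Set.Ioi (0 : ℝ)))).exists
  have hδ0' : (0 : ℝ) < δ := hδ0
  set Q := Set.univ.pi fun i => Set.Ioo (a i - δ) (b i + δ) with hQ
  have hvol : volume Q = ENNReal.ofReal (∏ i, ((b i + δ) - (a i - δ))) := by
    rw [hQ, volume_pi_pi, ENNReal.ofReal_prod_of_nonneg fun i _ => by linarith [hab i]]
    simp
  have hvol0 : volume Q ≠ 0 := by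
    rw [hvol]
    simp only [ne_eq, ENNReal.ofReal_eq_zero, not_le]
    exact Finset.prod_pos fun i _ => by linarith [hab i]
  have hsub : (Set.univ.pi fun i => Set.Icc (a i) (b i)) ⊆ Q :=
    Set.pi_mono fun i _ t ht => ⟨by linarith [ht.1], by linarith [ht.2]⟩
  have hlt : volume Q < 2 * volume (A ∩ Q) :=
    (hvol.trans_lt hδ).trans_le (mul_le_mul_right (measure_mono (Set.inter_subset_inter_right _ hsub)) _)
  have hQtop : volume Q ≠ ∞ := by rw [hvol]; exact ENNReal.ofReal_ne_top
  calc (1 / 2 : ℝ≥0∞) < volume (A ∩ Q) / volume Q := by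
        rw [ENNReal.lt_div_iff_mul_lt (Or.inl hvol0) (Or.inl hQtop), one_div, mul_comm,
          ← div_eq_mul_inv]
        exact ENNReal.div_lt_of_lt_mul' hlt
    _ = ⨍⁻ y in Q, ‖A.indicator (fun _ => (1 : ℝ)) y‖ₑ ∂volume := by
        rw [setLAverage_eq]
        simp only [enorm_indicator_one]
        rw [lintegral_indicator_const hA, one_mul, Measure.restrict_apply hA]
    _ ≤ maximalIndicator A x :=
        le_iSup_of_le (fun i => a i - δ) (le_iSup_of_le (fun i => b i + δ)
          (le_iSup_of_le (hsub hx) le_rfl))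


namespace DyadicInterval

instance : Countable DyadicInterval :=
  Function.Injective.countable (f := fun I : DyadicInterval => (I.scale, I.pos))
    fun I J h => by
      simp only [Prod.mk.injEq] at h
      exact DyadicInterval.ext h.1 h.2

/-- The left endpoint. -/
def left (I : DyadicInterval) : ℝ := I.pos * (2 : ℝ) ^ I.scale

lemma length_pos (I : DyadicInterval) : 0 < I.length := zpow_pos (by norm_num) _

lemma toSet_eq (I : DyadicInterval) : I.toSet = Set.Ico I.left (I.left + I.length) := by
  simp only [toSet, left, length, add_mul, one_mul]

lemma center_eq (I : DyadicInterval) : I.center = I.left + I.length / 2 := by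
  simp only [center, left, length]; ring

lemma left_mem (I : DyadicInterval) : I.left ∈ I.toSet := by
  rw [toSet_eq]; exact ⟨le_rfl, by linarith [I.length_pos]⟩

lemma center_mem (I : DyadicInterval) : I.center ∈ I.toSet := by
  rw [toSet_eq, center_eq]; constructor <;> linarith [I.length_pos]

lemma dilate_one (I : DyadicInterval) : I.dilate 1 = I.toSet := by
  rw [dilate, toSet_eq, center_eq]; congr 1 <;> ring

lemma volume_toSet (I : DyadicInterval) : volume I.toSet = ENNReal.ofReal I.length := by
  rw [toSet_eq, Real.volume_Ico]; congr 1; ring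

lemma measurableSet_toSet (I : DyadicInterval) : MeasurableSet I.toSet := measurableSet_Ico

lemma exists_scale_eq_mem (k : ℤ) (t : ℝ) : ∃ I : DyadicInterval, I.scale = k ∧ t ∈ I.toSet := by
  have h : (0 : ℝ) < 2 ^ k := zpow_pos (by norm_num) k
  refine ⟨⟨k, ⌊t / 2 ^ k⌋⟩, rfl, ?_, ?_⟩
  · exact (le_div_iff₀ h).1 (Int.floor_le _)
  · exact (div_lt_iff₀ h).1 (Int.lt_floor_add_one _)

/-- Dyadic intervals are nested. -/
lemma toSet_subset {I J : DyadicInterval} (hs : I.scale ≤ J.scale) {t : ℝ} (hI : t ∈ I.toSet)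
    (hJ : t ∈ J.toSet) : I.toSet ⊆ J.toSet := by
  obtain ⟨k, hk⟩ := Int.eq_ofNat_of_zero_le (sub_nonneg.2 hs)
  have h : (0 : ℝ) < 2 ^ I.scale := zpow_pos (by norm_num) _
  have e : (2 : ℝ) ^ J.scale = 2 ^ k * 2 ^ I.scale := by
    rw [show J.scale = k + I.scale by omega, zpow_add₀ (by norm_num), zpow_natCast]
  simp only [toSet, e, Set.mem_Ico, ← mul_assoc] at hI hJ ⊢
  have h1 : (J.pos * 2 ^ k : ℝ) < I.pos + 1 := lt_of_mul_lt_mul_right (hJ.1.trans_lt hI.2) h.le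
  have h2 : (I.pos : ℝ) < (J.pos + 1) * 2 ^ k := lt_of_mul_lt_mul_right (hI.1.trans_lt hJ.2) h.le
  have h3 : J.pos * 2 ^ k ≤ I.pos := Int.lt_add_one_iff.1 (by exact_mod_cast h1)
  have h4 : I.pos + 1 ≤ (J.pos + 1) * 2 ^ k := Int.add_one_le_iff.2 (by exact_mod_cast h2)
  refine Set.Ico_subset_Ico ?_ ?_
  · exact mul_le_mul_of_nonneg_right (by exact_mod_cast h3) h.le
  · exact mul_le_mul_of_nonneg_right (by exact_mod_cast h4) h.le

lemma eq_of_scale_eq {I J : DyadicInterval} (hs : I.scale = J.scale) {t : ℝ} (hI : t ∈ I.toSet)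
    (hJ : t ∈ J.toSet) : I = J := by
  refine DyadicInterval.ext hs ?_
  have h : (0 : ℝ) < 2 ^ J.scale := zpow_pos (by norm_num) _
  simp only [toSet, hs, Set.mem_Ico] at hI hJ
  have h1 : (J.pos : ℝ) < I.pos + 1 := lt_of_mul_lt_mul_right (hJ.1.trans_lt hI.2) h.le
  have h2 : (I.pos : ℝ) < J.pos + 1 := lt_of_mul_lt_mul_right (hI.1.trans_lt hJ.2) h.le
  norm_cast at h1 h2
  omega

end DyadicInterval

lemma DyadicRect.measurableSet_toSet (R : DyadicRect d) : MeasurableSet R.toSet :=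
  .univ_pi fun i => (R i).measurableSet_toSet

lemma DyadicRect.volume_toSet (R : DyadicRect d) :
    volume R.toSet = ∏ i, ENNReal.ofReal (R i).length := by
  simp only [DyadicRect.toSet, volume_pi_pi, DyadicInterval.volume_toSet]

lemma DyadicRect.volume_toSet_ne_zero (R : DyadicRect d) : volume R.toSet ≠ 0 := by
  rw [R.volume_toSet]
  exact Finset.prod_ne_zero_iff.2 fun i _ => by simpa using (R i).length_pos

lemma DyadicRect.volume_toSet_ne_top (R : DyadicRect d) : volume R.toSet ≠ ∞ := by
  rw [R.volume_toSet]
  exact ENNReal.prod_ne_top fun i _ => ENNReal.ofReal_ne_top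

lemma measurableSet_shadow (U : Set (DyadicRect d)) : MeasurableSet (shadow U) :=
  .biUnion U.to_countable fun R _ => R.measurableSet_toSet

lemma shadow_mono {U V : Set (DyadicRect d)} (h : U ⊆ V) : shadow U ⊆ shadow V :=
  Set.biUnion_subset_biUnion_left h

lemma subset_shadow {U : Set (DyadicRect d)} {R : DyadicRect d} (hR : R ∈ U) :
    R.toSet ⊆ shadow U :=
  Set.subset_biUnion_of_mem (u := fun R : DyadicRect d => R.toSet) hR

variable [NeZero d]

lemma measurableSet_unionF (U U' : Set (DyadicRect d)) (I : DyadicInterval) (j : ℕ) :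
    MeasurableSet (unionF U U' I j) := measurableSet_shadow _

lemma unionF_subset_shadow (U U' : Set (DyadicRect d)) (I : DyadicInterval) (j : ℕ) :
    unionF U U' I j ⊆ shadow U' := shadow_mono fun _ hR => hR.1

lemma apply_zero_mem_of_mem_unionF {U U' : Set (DyadicRect d)} {I : DyadicInterval} {j : ℕ}
    {x : Fin d → ℝ} (hx : x ∈ unionF U U' I j) : x 0 ∈ I.toSet := by
  obtain ⟨R, hR, hxR⟩ := Set.mem_iUnion₂.1 hx
  exact hR.2.1 ▸ hxR 0 trivial

/-- The union of the sets `F(J, j)` over the intervals `J` of scale at least `s`. -/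
def coarse (U U' : Set (DyadicRect d)) (s : ℤ) (j : ℕ) : Set (Fin d → ℝ) :=
  ⋃ (J : DyadicInterval) (_ : s ≤ J.scale), unionF U U' J j

/-- The part of `F(I, j)` outside the sets `F(J, j)` with `J` at least `2 ^ j` times as long. -/
def fresh (U U' : Set (DyadicRect d)) (I : DyadicInterval) (j : ℕ) : Set (Fin d → ℝ) :=
  unionF U U' I j \ coarse U U' (I.scale + j) j

lemma measurableSet_coarse (U U' : Set (DyadicRect d)) (s : ℤ) (j : ℕ) :
    MeasurableSet (coarse U U' s j) :=
  .iUnion fun J => .iUnion fun _ => measurableSet_unionF U U' J j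

lemma measurableSet_fresh (U U' : Set (DyadicRect d)) (I : DyadicInterval) (j : ℕ) :
    MeasurableSet (fresh U U' I j) :=
  (measurableSet_unionF U U' I j).diff (measurableSet_coarse U U' _ j)

/-- Lengthening the first side of `R` preserves the proportion covered by coarser sets. -/
lemma volume_coarse_inter_le (U U' : Set (DyadicRect d)) (R : DyadicRect d) (j : ℕ)
    {I₀ : DyadicInterval} (hs : I₀.scale = (R 0).scale + j) (hI₀ : (R 0).toSet ⊆ I₀.toSet) :
    2 ^ j * volume (coarse U U' I₀.scale j ∩ R.toSet) ≤
      volume (coarse U U' I₀.scale j ∩ DyadicRect.toSet (Function.update R 0 I₀)) := by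
  set V := coarse U U' I₀.scale j
  set R₀ : DyadicRect d := Function.update R 0 I₀ with hR₀
  have hV : MeasurableSet V := measurableSet_coarse _ _ _ _
  have hm : MeasurableSet (V ∩ R.toSet) := hV.inter R.measurableSet_toSet
  have hm₀ : MeasurableSet (V ∩ R₀.toSet) := hV.inter R₀.measurableSet_toSet
  rw [← lintegral_indicator_const hm, ← lintegral_indicator_one hm₀]
  refine lintegral_le_of_forall_line 0 (measurable_const.indicator hm)
    (measurable_one.indicator hm₀) fun x => ?_
  by_cases hx : ∃ t, Function.update x 0 t ∈ V ∩ R.toSet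
  · obtain ⟨t, htV, htR⟩ := hx
    have htI : t ∈ (R 0).toSet := by simpa using htR 0 trivial
    have hall : ∀ s ∈ I₀.toSet, Function.update x 0 s ∈ V ∩ R₀.toSet := by
      intro s hs₀
      constructor
      · obtain ⟨J, hJ, hQ⟩ := Set.mem_iUnion₂.1 htV
        obtain ⟨Q, hQmem, hxQ⟩ := Set.mem_iUnion₂.1 hQ
        refine Set.mem_iUnion₂.2 ⟨J, hJ, Set.mem_iUnion₂.2 ⟨Q, hQmem, fun i _ => ?_⟩⟩
        rcases eq_or_ne i 0 with rfl | hi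
        · have htJ : t ∈ J.toSet := by simpa [hQmem.2.1] using hxQ 0 trivial
          simpa [hQmem.2.1] using DyadicInterval.toSet_subset hJ (hI₀ htI) htJ hs₀
        · simpa [hi] using hxQ i trivial
      · intro i _
        rcases eq_or_ne i 0 with rfl | hi
        · simpa [hR₀] using hs₀
        · simpa [hR₀, hi] using htR i trivial
    calc ∫⁻ s, (V ∩ R.toSet).indicator (fun _ => 2 ^ j) (Function.update x 0 s)
        ≤ ∫⁻ s, (R 0).toSet.indicator (fun _ => 2 ^ j) s := by
          refine lintegral_mono fun s => ?_
          by_cases hs : Function.update x 0 s ∈ V ∩ R.toSet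
          · have : s ∈ (R 0).toSet := by simpa using hs.2 0 trivial
            rw [Set.indicator_of_mem hs, Set.indicator_of_mem this]
          · rw [Set.indicator_of_notMem hs]; exact zero_le
      _ = volume I₀.toSet := by
          rw [lintegral_indicator_const (R 0).measurableSet_toSet, DyadicInterval.volume_toSet,
            DyadicInterval.volume_toSet, DyadicInterval.length, DyadicInterval.length, hs,
            zpow_add₀ (by norm_num), mul_comm, ENNReal.ofReal_mul (by positivity)]
          congr 1
          rw [zpow_natCast, ENNReal.ofReal_pow (by norm_num), ENNReal.ofReal_ofNat]
      _ = ∫⁻ s, I₀.toSet.indicator 1 s := (lintegral_indicator_one I₀.measurableSet_toSet).symm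
      _ ≤ _ := by
          refine lintegral_mono fun s => ?_
          by_cases hs : s ∈ I₀.toSet
          · rw [Set.indicator_of_mem hs, Set.indicator_of_mem (hall s hs)]; rfl
          · rw [Set.indicator_of_notMem hs]; exact zero_le
  · push Not at hx
    simp [Set.indicator_of_notMem (hx _)]

lemma dilate_subset_enlargement {U U' : Set (DyadicRect d)} (hU : U' ⊆ U) {R : DyadicRect d}
    {j : ℕ} (h : 4 * volume R.toSet < 5 * volume (coarse U U' ((R 0).scale + j) j ∩ R.toSet)) :
    DyadicRect.dilate (Function.update (fun _ => 1) 0 (2 ^ j)) R ⊆ enlargement U := by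
  intro x hx
  obtain ⟨I₀, hs, hmem⟩ := DyadicInterval.exists_scale_eq_mem ((R 0).scale + j) (R 0).left
  have hI₀ : (R 0).toSet ⊆ I₀.toSet :=
    DyadicInterval.toSet_subset (by omega) (R 0).left_mem hmem
  have hlen : I₀.length = 2 ^ j * (R 0).length := by
    rw [DyadicInterval.length, hs, zpow_add₀ (by norm_num), zpow_natCast, mul_comm]; rfl
  have hV := volume_coarse_inter_le U U' R j hs hI₀
  rw [hs] at hV
  set V := coarse U U' ((R 0).scale + j) j
  set R₀ : DyadicRect d := Function.update R 0 I₀ with hR₀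
  set a : Fin d → ℝ := fun i => min (R₀ i).left (x i) with ha
  set b : Fin d → ℝ := fun i => max ((R₀ i).left + (R₀ i).length) (x i) with hb
  have hab : ∀ i, a i < b i := fun i => by
    have := (R₀ i).length_pos
    exact (min_le_left _ _).trans_lt (lt_of_lt_of_le (by linarith) (le_max_left _ _))
  have hxab : x ∈ Set.univ.pi fun i => Set.Icc (a i) (b i) :=
    fun i _ => ⟨min_le_right _ _, le_max_right _ _⟩
  have hside : ∀ i, ENNReal.ofReal (b i - a i) ≤
      (if 0 = i then 3 / 2 else 1) * ENNReal.ofReal (R₀ i).length := by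
    intro i
    have hxi := hx i trivial
    rcases eq_or_ne i 0 with rfl | hi
    · have hc := hI₀ (R 0).center_mem
      rw [DyadicInterval.toSet_eq] at hc
      simp only [Function.update_self, DyadicInterval.dilate, ← hlen] at hxi
      have h32 : (3 / 2 : ℝ≥0∞) = ENNReal.ofReal (3 / 2) := by
        rw [ENNReal.ofReal_div_of_pos (by norm_num)]; simp
      rw [if_pos rfl, h32, ← ENNReal.ofReal_mul (by norm_num)]
      refine ENNReal.ofReal_le_ofReal ?_
      simp only [ha, hb, hR₀, Function.update_self]
      obtain ⟨h1, h2⟩ := hxi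
      obtain ⟨h3, h4⟩ := hc
      rcases min_cases I₀.left (x 0) with h5 | h5 <;>
        rcases max_cases (I₀.left + I₀.length) (x 0) with h6 | h6 <;> linarith [I₀.length_pos]
    · rw [if_neg hi.symm, one_mul]
      simp only [ne_eq, hi, not_false_eq_true, Function.update_of_ne,
        DyadicInterval.dilate_one] at hxi
      rw [DyadicInterval.toSet_eq] at hxi
      refine ENNReal.ofReal_le_ofReal ?_
      simp only [ha, hb, hR₀, Function.update_of_ne hi]
      rw [min_eq_left hxi.1, max_eq_left hxi.2.le]
      linarith
  have hbox : volume (Set.univ.pi fun i => Set.Icc (a i) (b i)) ≤ 3 / 2 * volume R₀.toSet := by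
    simp only [volume_pi_pi, Real.volume_Icc]
    refine (Finset.prod_le_prod' fun i _ => hside i).trans_eq ?_
    rw [Finset.prod_mul_distrib, Finset.prod_ite_eq, if_pos (Finset.mem_univ _), R₀.volume_toSet]
  have hR₀vol : volume R₀.toSet = 2 ^ j * volume R.toSet := by
    have : ∀ i, ENNReal.ofReal (R₀ i).length =
        (if 0 = i then 2 ^ j else 1) * ENNReal.ofReal (R i).length := by
      intro i
      rcases eq_or_ne i 0 with rfl | hi
      · rw [if_pos rfl, hR₀, Function.update_self, hlen, ENNReal.ofReal_mul (by positivity),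
          ENNReal.ofReal_pow (by norm_num), ENNReal.ofReal_ofNat]
      · rw [if_neg hi.symm, one_mul, hR₀, Function.update_of_ne hi]
    rw [R₀.volume_toSet, R.volume_toSet, Finset.prod_congr rfl fun i _ => this i,
      Finset.prod_mul_distrib, Finset.prod_ite_eq, if_pos (Finset.mem_univ _)]
  refine half_lt_maximalIndicator (measurableSet_shadow U) hab hxab ?_
  have hsub : V ∩ R₀.toSet ⊆ shadow U ∩ Set.univ.pi fun i => Set.Icc (a i) (b i) := by
    refine Set.inter_subset_inter ?_ (Set.pi_mono fun i _ => ?_)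
    · exact Set.iUnion₂_subset fun J _ => (unionF_subset_shadow _ _ _ _).trans (shadow_mono hU)
    · rw [DyadicInterval.toSet_eq]
      exact fun t ht => ⟨(min_le_left _ _).trans ht.1, ht.2.le.trans (le_max_left _ _)⟩
  have h83 : (8 : ℝ≥0∞) * (3 / 2) = 3 * 4 := by
    rw [show (8 : ℝ≥0∞) = 4 * 2 by norm_num, mul_assoc,
      ENNReal.mul_div_cancel (by norm_num) (by norm_num), mul_comm]
  refine (ENNReal.mul_lt_mul_iff_right (a := 8) (by norm_num) (by norm_num)).1 ?_
  calc 8 * volume (Set.univ.pi fun i => Set.Icc (a i) (b i))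
      ≤ 8 * (3 / 2 * (2 ^ j * volume R.toSet)) := by rw [← hR₀vol]; exact mul_le_mul_right hbox _
    _ = (3 * 2 ^ j) * (4 * volume R.toSet) := by rw [← mul_assoc, h83]; ring
    _ < (3 * 2 ^ j) * (5 * volume (V ∩ R.toSet)) :=
        (ENNReal.mul_lt_mul_iff_right (by positivity)
          (ENNReal.mul_ne_top (by norm_num) (ENNReal.pow_ne_top (by norm_num)))).2 h
    _ = 15 * (2 ^ j * volume (V ∩ R.toSet)) := by ring
    _ ≤ 16 * volume (V ∩ R₀.toSet) := mul_le_mul' (by norm_num) hV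
    _ ≤ 16 * volume (shadow U ∩ Set.univ.pi fun i => Set.Icc (a i) (b i)) :=
        mul_le_mul_right (measure_mono hsub) _
    _ = _ := by rw [← mul_assoc]; norm_num

/-- A rectangle that makes up `F(I, j)` meets the fresh part of `F(I, j)` in a fifth of its
volume. -/
lemma volume_toSet_le_volume_inter_fresh {U U' : Set (DyadicRect d)} (hU : U' ⊆ U)
    {R : DyadicRect d} {j : ℕ} (hR : R ∈ U') (h1 : (2 : ℝ≥0∞) ^ ((j : ℤ) - 1) ≤ emb R U)
    (h2 : emb R U < 2 ^ (j : ℤ)) :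
    volume R.toSet ≤ 5 * volume (R.toSet ∩ fresh U U' (R 0) j) := by
  set V := coarse U U' ((R 0).scale + j) j
  have hV : MeasurableSet V := measurableSet_coarse _ _ _ _
  have hRF : R.toSet ⊆ unionF U U' (R 0) j := subset_shadow ⟨hR, rfl, h1, h2⟩
  have hnot : ¬ 4 * volume R.toSet < 5 * volume (V ∩ R.toSet) := by
    intro hlt
    refine h2.not_ge ?_
    have := dilate_subset_enlargement hU hlt
    calc (2 : ℝ≥0∞) ^ (j : ℤ) = ENNReal.ofReal (2 ^ j) := by
          rw [ENNReal.ofReal_pow (by norm_num), ENNReal.ofReal_ofNat, zpow_natCast]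
      _ ≤ emb R U := le_iSup_of_le (2 ^ j) (le_iSup_of_le (one_le_pow₀ (by norm_num))
          (le_iSup_of_le this le_rfl))
  have hsplit : volume R.toSet = volume (V ∩ R.toSet) + volume (R.toSet ∩ fresh U U' (R 0) j) := by
    rw [← measure_inter_add_sdiff R.toSet hV, Set.inter_comm]
    congr 2
    ext x
    simp only [fresh, Set.mem_sdiff, Set.mem_inter_iff]
    exact ⟨fun h => ⟨h.1, hRF h.1, h.2⟩, fun h => ⟨h.1, h.2.2⟩⟩
  refine (ENNReal.add_le_add_iff_left (a := 4 * volume R.toSet)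
    (ENNReal.mul_ne_top (by norm_num) R.volume_toSet_ne_top)).1 ?_
  calc 4 * volume R.toSet + volume R.toSet = 5 * volume R.toSet := by ring
    _ = 5 * volume (V ∩ R.toSet) + 5 * volume (R.toSet ∩ fresh U U' (R 0) j) := by
        conv_lhs => rw [hsplit]
        rw [mul_add]
    _ ≤ _ := add_le_add_left (not_lt.1 hnot) _

/-- The sets `F(I, j)` are controlled by the maximal functions of their fresh parts. -/
lemma one_le_iterMax_fresh {U U' : Set (DyadicRect d)} (hU : U' ⊆ U) {I : DyadicInterval} {j : ℕ}
    {x : Fin d → ℝ} (hx : x ∈ unionF U U' I j) :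
    1 ≤ 5 * 2 ^ d * iterMax (List.finRange d)
      ((fresh U U' I j).indicator fun _ => (1 : ℝ≥0∞)) x := by
  obtain ⟨R, ⟨hR, rfl, h1, h2⟩, hxR⟩ := Set.mem_iUnion₂.1 hx
  have hD := measurableSet_fresh U U' (R 0) j
  set D := fresh U U' (R 0) j
  set Q := Set.univ.pi fun i => Set.Icc (R i).left ((R i).left + (R i).length) with hQ
  have hsub : R.toSet ⊆ Q := Set.pi_mono fun i _ => by
    rw [DyadicInterval.toSet_eq]; exact Set.Ico_subset_Icc_self
  have hvol : volume Q = volume R.toSet := by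
    rw [hQ, R.volume_toSet, volume_pi_pi]; simp
  have key := lintegral_Icc_le_iterMax (measurable_const.indicator hD : Measurable
    (D.indicator fun _ => (1 : ℝ≥0∞))) (fun i => by linarith [(R i).length_pos]) (hsub hxR)
  rw [lintegral_indicator_const hD, one_mul, Measure.restrict_apply hD, ← hQ, hvol] at key
  refine (ENNReal.mul_le_mul_iff_right R.volume_toSet_ne_zero R.volume_toSet_ne_top).1 ?_
  calc volume R.toSet * 1 ≤ 5 * volume (R.toSet ∩ D) := by
        rw [mul_one]; exact volume_toSet_le_volume_inter_fresh hU hR h1 h2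
    _ ≤ 5 * volume (D ∩ Q) := by
        rw [Set.inter_comm]; gcongr
    _ ≤ 5 * (volume R.toSet * (2 ^ d * _)) := mul_le_mul_right key _
    _ = _ := by ring

/-- At most `j` of the sets `fresh U U' I j` contain a given point. -/
lemma tsum_indicator_fresh_le (U U' : Set (DyadicRect d)) (j : ℕ) (x : Fin d → ℝ) :
    ∑' I : DyadicInterval, (fresh U U' I j).indicator (fun _ => (1 : ℝ≥0∞)) x ≤
      j * (shadow U').indicator (fun _ => 1) x := by
  classical
  by_cases hx : x ∈ shadow U'
  swap
  · have : ∀ I, x ∉ fresh U U' I j := fun I h => hx (unionF_subset_shadow U U' I j h.1)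
    simp [this]
  rw [Set.indicator_of_mem hx, mul_one, ENNReal.tsum_eq_iSup_sum]
  refine iSup_le fun s => ?_
  set T := s.filter fun I => x ∈ fresh U U' I j with hT
  have hsum : ∑ I ∈ s, (fresh U U' I j).indicator (fun _ => (1 : ℝ≥0∞)) x = T.card := by
    simp [Set.indicator_apply, hT]
  rw [hsum]
  norm_cast
  rcases T.eq_empty_or_nonempty with h0 | hne
  · simp [h0]
  obtain ⟨I₁, hI₁, hmin⟩ := T.exists_min_image DyadicInterval.scale hne
  have hmem : ∀ I ∈ T, x ∈ fresh U U' I j := fun I hI => (Finset.mem_filter.1 hI).2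
  have hcard : T.card ≤ (Finset.Ico I₁.scale (I₁.scale + j)).card := by
    refine Finset.card_le_card_of_injOn DyadicInterval.scale (fun I hI => ?_) fun I hI J hJ hs => ?_
    · refine Finset.mem_coe.2 (Finset.mem_Ico.2 ⟨hmin I hI, ?_⟩)
      by_contra hcon
      exact (hmem I₁ hI₁).2 (Set.mem_iUnion₂.2 ⟨I, not_lt.1 hcon, (hmem I hI).1⟩)
    · exact DyadicInterval.eq_of_scale_eq hs (apply_zero_mem_of_mem_unionF (hmem I hI).1)
        (apply_zero_mem_of_mem_unionF (hmem J hJ).1)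
  simpa using hcard

/-- The weight `2 ^ (-ε j)`. -/
def weight (ε : ℝ) (k : ℕ+ × DyadicInterval) : ℝ≥0∞ := (2 : ℝ≥0∞) ^ (-(ε * ((k.1 : ℕ) : ℝ)))

lemma tsum_mul_weight_ne_top {ε : ℝ} (hε : 0 < ε) :
    ∑' j : ℕ+, (2 : ℝ≥0∞) ^ (-(ε * ((j : ℕ) : ℝ))) * ((j : ℕ) : ℝ≥0∞) ≠ ∞ := by
  have h1 : Summable fun j : ℕ => (j : ℝ) ^ 1 * ((2 : ℝ) ^ (-ε)) ^ j := by
    refine summable_pow_mul_geometric_of_norm_lt_one 1 ?_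
    rw [Real.norm_of_nonneg (by positivity)]
    exact Real.rpow_lt_one_of_one_lt_of_neg (by norm_num) (by linarith)
  refine ne_top_of_le_ne_top h1.tsum_ofReal_ne_top ?_
  refine le_trans (le_of_eq (tsum_congr fun j => ?_)) (ENNReal.tsum_comp_le_tsum_of_injective
    (f := fun j : ℕ+ => (j : ℕ)) PNat.coe_injective
    fun j : ℕ => ENNReal.ofReal ((j : ℝ) ^ 1 * ((2 : ℝ) ^ (-ε)) ^ j))
  rw [pow_one, ENNReal.ofReal_mul (by positivity), ENNReal.ofReal_natCast, mul_comm,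
    ← Real.rpow_natCast, ← Real.rpow_mul (by norm_num),
    ← ENNReal.ofReal_rpow_of_pos (by norm_num), ENNReal.ofReal_ofNat, neg_mul]

lemma tsum_weight_mul_fresh_le (ε : ℝ) (U U' : Set (DyadicRect d)) (x : Fin d → ℝ) :
    ∑' k : ℕ+ × DyadicInterval,
        weight ε k * (fresh U U' k.2 k.1).indicator (fun _ => (1 : ℝ≥0∞)) x ≤
      (∑' j : ℕ+, (2 : ℝ≥0∞) ^ (-(ε * ((j : ℕ) : ℝ))) * ((j : ℕ) : ℝ≥0∞)) *
        (shadow U').indicator (fun _ => 1) x := by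
  rw [ENNReal.tsum_prod', ← ENNReal.tsum_mul_right]
  refine ENNReal.tsum_le_tsum fun j => ?_
  simp only [weight]
  rw [ENNReal.tsum_mul_left, mul_assoc]
  exact mul_le_mul_right (tsum_indicator_fresh_le U U' j x) _

lemma tsum_volume_unionF_le {ε : ℝ} (hε : 0 < ε) :
    ∃ C : ℝ≥0∞, C ≠ ∞ ∧ ∀ U U' : Set (DyadicRect d), U' ⊆ U →
      ∑' k : ℕ+ × DyadicInterval, weight ε k * volume (unionF U U' k.2 k.1) ≤
        C * volume (shadow U') := by
  obtain ⟨B, hB, hmax⟩ := lintegral_iterMax_rpow_le (q := 2) (by norm_num) (List.finRange d)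
  set A := ∑' j : ℕ+, (2 : ℝ≥0∞) ^ (-(ε * ((j : ℕ) : ℝ))) * ((j : ℕ) : ℝ≥0∞)
  set c : ℝ≥0∞ := 5 * 2 ^ d
  have hc : c ≠ ∞ := ENNReal.mul_ne_top (by norm_num) (ENNReal.pow_ne_top (by norm_num))
  refine ⟨c ^ (2 : ℝ) * B * A, ENNReal.mul_ne_top (ENNReal.mul_ne_top
    (ENNReal.rpow_ne_top_of_nonneg (by norm_num) hc) hB) (tsum_mul_weight_ne_top hε),
    fun U U' hU => ?_⟩
  have hD : ∀ k : ℕ+ × DyadicInterval, MeasurableSet (fresh U U' k.2 k.1) :=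
    fun k => measurableSet_fresh U U' k.2 k.1
  have hF : ∀ k : ℕ+ × DyadicInterval, volume (unionF U U' k.2 k.1) ≤
      c ^ (2 : ℝ) * (B * volume (fresh U U' k.2 k.1)) := by
    intro k
    set D := fresh U U' k.2 k.1
    have hDm : Measurable (D.indicator fun _ => (1 : ℝ≥0∞)) := measurable_const.indicator (hD k)
    calc volume (unionF U U' k.2 k.1) = ∫⁻ x, (unionF U U' k.2 k.1).indicator 1 x :=
          (lintegral_indicator_one (measurableSet_unionF _ _ _ _)).symm
      _ ≤ ∫⁻ x, c ^ (2 : ℝ) *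
          iterMax (List.finRange d) (D.indicator fun _ => (1 : ℝ≥0∞)) x ^ (2 : ℝ) := by
          refine lintegral_mono fun x => ?_
          by_cases hx : x ∈ unionF U U' k.2 k.1
          · rw [Set.indicator_of_mem hx, ← ENNReal.mul_rpow_of_nonneg _ _ (by norm_num)]
            exact ENNReal.one_le_rpow (one_le_iterMax_fresh hU hx) (by norm_num)
          · rw [Set.indicator_of_notMem hx]; exact zero_le
      _ = c ^ (2 : ℝ) * ∫⁻ x,
          iterMax (List.finRange d) (D.indicator fun _ => (1 : ℝ≥0∞)) x ^ (2 : ℝ) :=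
          lintegral_const_mul' _ _ (ENNReal.rpow_ne_top_of_nonneg (by norm_num) hc)
      _ ≤ c ^ (2 : ℝ) * (B * ∫⁻ x, (D.indicator fun _ => (1 : ℝ≥0∞)) x ^ (2 : ℝ)) :=
          mul_le_mul_right (hmax _ hDm) _
      _ = c ^ (2 : ℝ) * (B * ∫⁻ x, D.indicator 1 x) := by
          congr 3 with x
          by_cases hx : x ∈ D <;> simp [hx]
      _ = _ := by rw [lintegral_indicator_one (hD k)]
  calc ∑' k : ℕ+ × DyadicInterval, weight ε k * volume (unionF U U' k.2 k.1)
      ≤ ∑' k : ℕ+ × DyadicInterval,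
          c ^ (2 : ℝ) * B * (weight ε k * volume (fresh U U' k.2 k.1)) :=
        ENNReal.tsum_le_tsum fun k => (mul_le_mul_right (hF k) _).trans_eq (by ring)
    _ = c ^ (2 : ℝ) * B * ∫⁻ x, ∑' k : ℕ+ × DyadicInterval,
          weight ε k * (fresh U U' k.2 k.1).indicator (fun _ => (1 : ℝ≥0∞)) x := by
        rw [ENNReal.tsum_mul_left, lintegral_tsum fun k =>
          ((measurable_const.indicator (hD k)).const_mul _).aemeasurable]
        congr 1
        refine tsum_congr fun k => ?_
        rw [lintegral_const_mul _ (measurable_const.indicator (hD k)),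
          lintegral_indicator_const (hD k), one_mul]
    _ ≤ c ^ (2 : ℝ) * B * ∫⁻ x, A * (shadow U').indicator (fun _ => 1) x :=
        mul_le_mul_right (lintegral_mono fun x => tsum_weight_mul_fresh_le ε U U' x) _
    _ = _ := by
        rw [lintegral_const_mul _ (measurable_const.indicator (measurableSet_shadow U')),
          lintegral_indicator_const (measurableSet_shadow U'), one_mul, mul_assoc _ A]

lemma lintegral_tsum_maximalIndicator_le {ε : ℝ} (hε : 0 < ε) {n : ℕ} (hn : 1 < n) {p : ℝ}
    (hp : 1 < p) :
    ∃ C : ℝ≥0∞, C ≠ ∞ ∧ ∀ U U' : Set (DyadicRect d), U' ⊆ U →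
      ∫⁻ x, (∑' k : ℕ+ × DyadicInterval,
        weight ε k * maximalIndicator (unionF U U' k.2 k.1) x ^ n) ^ p ≤
        C * volume (shadow U') := by
  obtain ⟨B, hB, hFS⟩ := fefferman_stein_iterMax hn hp (List.finRange d)
  have hp0 : 0 < p := by linarith
  set A := ∑' j : ℕ+, (2 : ℝ≥0∞) ^ (-(ε * ((j : ℕ) : ℝ))) * ((j : ℕ) : ℝ≥0∞)
  set c : ℝ≥0∞ := 5 * 2 ^ d
  have h2d : (2 : ℝ≥0∞) ^ d ≠ ∞ := ENNReal.pow_ne_top (by norm_num)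
  have hc : c ≠ ∞ := ENNReal.mul_ne_top (by norm_num) h2d
  have hK : ((2 ^ d * c) ^ n) ^ p ≠ ∞ := ENNReal.rpow_ne_top_of_nonneg hp0.le
    (ENNReal.pow_ne_top (ENNReal.mul_ne_top h2d hc))
  refine ⟨((2 ^ d * c) ^ n) ^ p * (B * (B * A ^ p)), ENNReal.mul_ne_top hK (ENNReal.mul_ne_top hB
    (ENNReal.mul_ne_top hB (ENNReal.rpow_ne_top_of_nonneg hp0.le (tsum_mul_weight_ne_top hε)))),
    fun U U' hU => ?_⟩
  set M : ((Fin d → ℝ) → ℝ≥0∞) → (Fin d → ℝ) → ℝ≥0∞ := iterMax (List.finRange d)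
  set δ : ℕ+ × DyadicInterval → (Fin d → ℝ) → ℝ≥0∞ :=
    fun k => (fresh U U' k.2 k.1).indicator fun _ => 1 with hδ
  have hδm : ∀ k, Measurable (δ k) :=
    fun k => measurable_const.indicator (measurableSet_fresh U U' k.2 k.1)
  have hMδ : ∀ k, Measurable (M (δ k)) := fun k => measurable_iterMax _ (hδm k)
  have hpt : ∀ (k : ℕ+ × DyadicInterval) (x : Fin d → ℝ),
      maximalIndicator (unionF U U' k.2 k.1) x ≤ 2 ^ d * c * M (M (δ k)) x := by
    intro k x
    calc _ ≤ 2 ^ d * M ((unionF U U' k.2 k.1).indicator fun _ => (1 : ℝ≥0∞)) x :=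
          maximalIndicator_le_iterMax (measurableSet_unionF U U' k.2 k.1) x
      _ ≤ 2 ^ d * M (fun y => c * M (δ k) y) x := by
          refine mul_le_mul_right (iterMax_mono _ (fun y => ?_) x) _
          by_cases hy : y ∈ unionF U U' k.2 k.1
          · rw [Set.indicator_of_mem hy]; exact one_le_iterMax_fresh hU hy
          · rw [Set.indicator_of_notMem hy]; exact zero_le
      _ ≤ 2 ^ d * (c * M (M (δ k)) x) := mul_le_mul_right (iterMax_const_mul_le _ _ hc x) _
      _ = _ := (mul_assoc _ _ _).symm
  calc ∫⁻ x, (∑' k : ℕ+ × DyadicInterval,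
        weight ε k * maximalIndicator (unionF U U' k.2 k.1) x ^ n) ^ p
      ≤ ∫⁻ x, ((2 ^ d * c) ^ n) ^ p *
          (∑' k : ℕ+ × DyadicInterval, weight ε k * M (M (δ k)) x ^ n) ^ p := by
        refine lintegral_mono fun x => ?_
        rw [← ENNReal.mul_rpow_of_nonneg _ _ hp0.le, ← ENNReal.tsum_mul_left]
        refine ENNReal.rpow_le_rpow (ENNReal.tsum_le_tsum fun k => ?_) hp0.le
        rw [mul_left_comm, ← mul_pow]
        exact mul_le_mul_right (pow_le_pow_left' (hpt k x) n) _
    _ = ((2 ^ d * c) ^ n) ^ p *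
          ∫⁻ x, (∑' k : ℕ+ × DyadicInterval, weight ε k * M (M (δ k)) x ^ n) ^ p :=
        lintegral_const_mul' _ _ hK
    _ ≤ ((2 ^ d * c) ^ n) ^ p *
          (B * (B * ∫⁻ x, (∑' k : ℕ+ × DyadicInterval, weight ε k * δ k x ^ n) ^ p)) :=
        mul_le_mul_right ((hFS _ _ _ hMδ).trans (mul_le_mul_right (hFS _ _ _ hδm) _)) _
    _ ≤ ((2 ^ d * c) ^ n) ^ p *
          (B * (B * ∫⁻ x, A ^ p * (shadow U').indicator (fun _ => 1) x)) := by
        refine mul_le_mul_right (mul_le_mul_right (mul_le_mul_right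
          (lintegral_mono fun x => ?_) _) _) _
        have hpow : ∀ k, δ k x ^ n = δ k x := by
          intro k
          by_cases hx : x ∈ fresh U U' k.2 k.1
          · simp [hδ, hx]
          · simp only [hδ, Set.indicator_of_notMem hx, zero_pow (by omega : n ≠ 0)]
        simp only [hpow]
        refine (ENNReal.rpow_le_rpow (tsum_weight_mul_fresh_le ε U U' x) hp0.le).trans_eq ?_
        rw [ENNReal.mul_rpow_of_nonneg _ _ hp0.le]
        by_cases hx : x ∈ shadow U'
        · simp [hx, A]
        · simp [hx, hp0]
    _ = _ := by
        rw [lintegral_const_mul _ (measurable_const.indicator (measurableSet_shadow U')),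
          lintegral_indicator_const (measurableSet_shadow U'), one_mul]
        ring

end Journe

end

theorem lemmal (d : ℕ) [NeZero d] (ε : ℝ) (hε : 0 < ε) :
    (∃ C : ℝ≥0, ∀ U : Set (Journe.DyadicRect d), volume (Journe.shadow U) < ∞ →
      ∀ U' : Set (Journe.DyadicRect d), U' ⊆ U →
        ∑' (j : ℕ+) (I : Journe.DyadicInterval),
            (2 : ℝ≥0∞) ^ (-(ε * ((j : ℕ) : ℝ))) * volume (Journe.unionF U U' I j)
          ≤ C * volume (Journe.shadow U')) ∧
    (∀ n : ℕ, 1 < n → ∀ p : ℝ, 1 < p →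
      ∃ C : ℝ≥0, ∀ U : Set (Journe.DyadicRect d), volume (Journe.shadow U) < ∞ →
        ∀ U' : Set (Journe.DyadicRect d), U' ⊆ U →
          eLpNorm (fun x => ∑' (j : ℕ+) (I : Journe.DyadicInterval),
              (2 : ℝ≥0∞) ^ (-(ε * ((j : ℕ) : ℝ))) *
                Journe.maximalIndicator (Journe.unionF U U' I j) x ^ n)
            (ENNReal.ofReal p) volume
          ≤ C * volume (Journe.shadow U') ^ (1 / p)) := by
  constructor
  · obtain ⟨C, hC, h⟩ := Journe.tsum_volume_unionF_le (d := d) hε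
    lift C to ℝ≥0 using hC
    refine ⟨C, fun U _ U' hU => ?_⟩
    have := h U U' hU
    rw [ENNReal.tsum_prod'] at this
    exact this
  · intro n hn p hp
    have hp0 : 0 < p := by linarith
    obtain ⟨C, hC, h⟩ := Journe.lintegral_tsum_maximalIndicator_le (d := d) hε hn hp
    have hC' : C ^ (1 / p) ≠ ∞ := ENNReal.rpow_ne_top_of_nonneg (by positivity) hC
    refine ⟨(C ^ (1 / p)).toNNReal, fun U _ U' hU => ?_⟩
    rw [ENNReal.coe_toNNReal hC', eLpNorm_eq_lintegral_rpow_enorm_toReal (by simpa using hp0)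
      ENNReal.ofReal_ne_top, ENNReal.toReal_ofReal hp0.le,
      ← ENNReal.mul_rpow_of_nonneg _ _ (by positivity)]
    refine ENNReal.rpow_le_rpow ?_ (by positivity)
    have := h U U' hU
    simp only [ENNReal.tsum_prod'] at this
    exact this
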